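/- **Setting.** Let $x^{+}=f(x,u)$, $x\in\mathbb R^n$, $u\in\mathbb R^2$, be a discrete-time system that is smooth near an equilibrium $(x_0,u_0)$, $f(x_0,u_0)=x_0$, with $\operatorname{rank}\partial_u f=2$ and $\operatorname{rank}\partial_{(x,u)}f=n$. Let $g=(g^1,g^2)$ be functions for which $(x,u)\mapsto(x^+,\zeta)=(f(x,u),g(x,u))$ is a local diffeomorphism at $(x_0,u_0)$, with local inverse $\psi=(\psi_x,\psi_u)$, and put $\zeta_0=g(x_0,u_0)$. On the space with coordinates $(\ldots,\zeta_{[-2]},\zeta_{[-1]},x,u)$ the backward shift of a function $h$ is $$(\delta^{-1}h)(\ldots,\zeta_{[-2]},\zeta_{[-1]},x,u)=h(\ldots,\zeta_{[-2]},\psi_x(x,\zeta_{[-1]}),\psi_u(x,\zeta_{[-1]})),$$ and $h_{[-k]}=\delta^{-k}h$. The equilibrium point of this space is $P_0=(\ldots,\zeta_0,\zeta_0,x_0,u_0)$; all statements are local around it. Let $y^j=\varphi^j(x,u)$, $j=1,2$, be smooth near $(x_0,u_0)$ with $\operatorname{rank}\partial_u\varphi=2$, and let it be a backward-flat output: there are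 $R_1=(r_{1,1},r_{1,2})$ and smooth maps $F_x,F_u$ such that, identically near $P_0$, $$x=F_x(y_{[-R_1,-1]}),\qquad u=F_u(y_{[-R_1,0]}),$$ where $y_{[-R_1,-1]}$ consists of the $y^j_{[-k]}$ with $1\le k\le r_{1,j}$ and $y_{[-R_1,0]}$ of those with $0\le k\le r_{1,j}$. Let $R_1$ be the least multi-index for which this is possible, and $\#R_1=r_{1,1}+r_{1,2}$. Let $\gamma_1$ be the least $k$ such that $y^1_{[-k]}=\varphi^1_{[-k]}$ depends on $\zeta_{[-1]}$ near $P_0$ (i.e. $\partial_{\zeta_{[-1]}}\varphi^1_{[-k]}$ does not vanish identically on any neighbourhood of $P_0$). Assume that the equilibrium is regular in the following sense (the numbering of the two components of $y$ is at our choice): $$\partial_{\zeta_{[-1]}}\varphi^1_{[-\gamma_1]}(P_0)\neq 0,\qquad \partial_{y^2_{[-r_{1,2}]}}F_x\neq 0\ \text{ at the value of } y_{[-R_1,-1]} \text{ at } P_0 .$$ **Proposition.** Put $d=\#R_1-n$. Then $d\ge 0$ and $d=r_{1,1}-\gamma_1+1$, and there is an invertible transformation $\zeta_{[-1]}=\hat\Phi_\zeta(x,\bar\zeta_{[-1]})$,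 i.e. smooth maps $T$ and $\hat\Phi_\zeta$, defined near $(x_0,\zeta_0)$ and $(x_0,T(x_0,\zeta_0))$, such that $\bar\zeta_{[-1]}=T(x,\zeta_{[-1]})$ and $\zeta_{[-1]}=\hat\Phi_\zeta(x,\bar\zeta_{[-1]})$ are equivalent there, with the following property. Let $\bar g^1(x,u)=T^1(f(x,u),g(x,u))$ be the forward shift of $\bar\zeta^1_{[-1]}$. Then the $d$-fold prelongation $$\bar\zeta^{1,+}_{[-d]}=\bar\zeta^{1}_{[-d+1]},\ \ \ldots,\ \ \bar\zeta^{1,+}_{[-2]}=\bar\zeta^{1}_{[-1]},\ \ \bar\zeta^{1,+}_{[-1]}=\bar g^1(x,u),\ \ x^{+}=f(x,u)$$ with state $(\bar\zeta^1_{[-d]},\ldots,\bar\zeta^1_{[-1]},x)$ and input $u$ is static feedback linearizable around its equilibrium $\bar\zeta^1_{[-k]}=\bar g^1(x_0,u_0)$, $x=x_0$, $u=u_0$: a local change of the state coordinates $z$ and an invertible input transformation, depending on the state, to a new input $v$ turn it into a linear controllable system $z^+=Az+Bv$. (For $d=0$ the prelongation is the system itself.) -/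

import Mathlib

open Filter Topology
open scoped ContDiff

/-- `h` is smooth on a neighbourhood of `p`. -/
def SmoothNear {E F : Type*} [NormedAddCommGroup E] [NormedSpace ℝ E]
    [NormedAddCommGroup F] [NormedSpace ℝ F] (h : E → F) (p : E) : Prop :=
  ∀ᶠ z in 𝓝 p, ContDiffAt ℝ ∞ h z

/-- `a` is a local diffeomorphism at `p`, and `b` is its local inverse near `a p`. -/
structure LocalDiffeoPair {E F : Type*} [NormedAddCommGroup E] [NormedSpace ℝ E]
    [NormedAddCommGroup F] [NormedSpace ℝ F] (a : E → F) (b : F → E) (p : E) : Prop where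
  smooth : SmoothNear a p
  smooth_inv : SmoothNear b (a p)
  left_inv : ∀ᶠ z in 𝓝 p, b (a z) = z
  right_inv : ∀ᶠ w in 𝓝 (a p), a (b w) = w

/-- The rank of a Jacobian, as a linear map. -/
noncomputable def jacobianRank {E F : Type*} [NormedAddCommGroup E] [NormedSpace ℝ E]
    [NormedAddCommGroup F] [NormedSpace ℝ F] (D : E →L[ℝ] F) : ℕ :=
  Module.finrank ℝ (LinearMap.range D.toLinearMap)

/-- The discrete-time system `x⁺ = f (x, u)` near an equilibrium `(x₀, u₀)`: it is smooth, the
inputs are independent (`rank ∂_u f = m`), and it is submersive (`rank ∂_{(x,u)} f = n`). The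
rank conditions are open, so it suffices to impose them at the equilibrium. -/
structure IsSystemAt {n m : ℕ} (f : (Fin n → ℝ) × (Fin m → ℝ) → (Fin n → ℝ))
    (x₀ : Fin n → ℝ) (u₀ : Fin m → ℝ) : Prop where
  smooth : SmoothNear f (x₀, u₀)
  equilibrium : f (x₀, u₀) = x₀
  independent_inputs : jacobianRank (fderiv ℝ (fun u => f (x₀, u)) u₀) = m
  submersive : jacobianRank (fderiv ℝ f (x₀, u₀)) = n

/-- The space with coordinates `(…, ζ_{[-2]}, ζ_{[-1]}, x, u)`; the entry `k` of the sequence is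
`ζ_{[-(k+1)]}`. It carries the product topology, so that a neighbourhood restricts only finitely
many of the coordinates. -/
abbrev ShiftSpace (n m : ℕ) : Type := (ℕ → Fin m → ℝ) × ((Fin n → ℝ) × (Fin m → ℝ))

/-- The point of `ShiftSpace` that belongs to the constant trajectory. -/
def equilibriumPoint {n m : ℕ} (ζ₀ : Fin m → ℝ) (x₀ : Fin n → ℝ) (u₀ : Fin m → ℝ) :
    ShiftSpace n m :=
  (fun _ => ζ₀, (x₀, u₀))

/-- `(…, ζ_{[-2]}, ζ_{[-1]}, x, u) ↦ (…, ζ_{[-3]}, ζ_{[-2]}, ψ_x(x, ζ_{[-1]}), ψ_u(x, ζ_{[-1]}))`. -/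
def backStep {n m : ℕ} (ψ : (Fin n → ℝ) × (Fin m → ℝ) → (Fin n → ℝ) × (Fin m → ℝ))
    (p : ShiftSpace n m) : ShiftSpace n m :=
  (fun k => p.1 (k + 1), ψ (p.2.1, p.1 0))

/-- The `k`-fold backward shift `h_{[-k]} = δ^{-k} h` of a function `h`. -/
def backShift {n m : ℕ} {α : Type*}
    (ψ : (Fin n → ℝ) × (Fin m → ℝ) → (Fin n → ℝ) × (Fin m → ℝ))
    (h : ShiftSpace n m → α) (k : ℕ) (p : ShiftSpace n m) : α :=
  h ((backStep ψ)^[k] p)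

/-- `y_{[-R,-1]}`: the entry `⟨j, k⟩` is `y^j_{[-(k+1)]}`, with `1 ≤ k + 1 ≤ R j`. -/
def strictShifts {n m : ℕ} (ψ : (Fin n → ℝ) × (Fin m → ℝ) → (Fin n → ℝ) × (Fin m → ℝ))
    (y : ShiftSpace n m → Fin m → ℝ) (R : Fin m → ℕ) (p : ShiftSpace n m) :
    (Σ j : Fin m, Fin (R j)) → ℝ :=
  fun s => backShift ψ y ((s.2 : ℕ) + 1) p s.1

/-- `y_{[-R,0]}`: the entry `⟨j, k⟩` is `y^j_{[-k]}`, with `0 ≤ k ≤ R j`. -/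
def allShifts {n m : ℕ} (ψ : (Fin n → ℝ) × (Fin m → ℝ) → (Fin n → ℝ) × (Fin m → ℝ))
    (y : ShiftSpace n m → Fin m → ℝ) (R : Fin m → ℕ) (p : ShiftSpace n m) :
    (Σ j : Fin m, Fin (R j + 1)) → ℝ :=
  fun s => backShift ψ y (s.2 : ℕ) p s.1

/-- `y` is a backward-flat output near the point `P₀`, with the parameterization
`x = F_x(y_{[-R,-1]})`, `u = F_u(y_{[-R,0]})`: both identities hold identically on a neighbourhood
of `P₀`, with `F_x`, `F_u` smooth near the image of `P₀`. -/
structure IsBackwardFlatParam {n m : ℕ}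
    (ψ : (Fin n → ℝ) × (Fin m → ℝ) → (Fin n → ℝ) × (Fin m → ℝ))
    (P₀ : ShiftSpace n m) (y : ShiftSpace n m → Fin m → ℝ) (R : Fin m → ℕ)
    (Fx : ((Σ j : Fin m, Fin (R j)) → ℝ) → (Fin n → ℝ))
    (Fu : ((Σ j : Fin m, Fin (R j + 1)) → ℝ) → (Fin m → ℝ)) : Prop where
  smooth_x : SmoothNear Fx (strictShifts ψ y R P₀)
  smooth_u : SmoothNear Fu (allShifts ψ y R P₀)
  param_x : ∀ᶠ p in 𝓝 P₀, p.2.1 = Fx (strictShifts ψ y R p)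
  param_u : ∀ᶠ p in 𝓝 P₀, p.2.2 = Fu (allShifts ψ y R p)

/-- The orders `R` suffice to express `x` and `u` by `y` and its backward shifts. -/
def HasBackwardFlatParam {n m : ℕ}
    (ψ : (Fin n → ℝ) × (Fin m → ℝ) → (Fin n → ℝ) × (Fin m → ℝ))
    (P₀ : ShiftSpace n m) (y : ShiftSpace n m → Fin m → ℝ) (R : Fin m → ℕ) : Prop :=
  ∃ (Fx : ((Σ j : Fin m, Fin (R j)) → ℝ) → (Fin n → ℝ))
    (Fu : ((Σ j : Fin m, Fin (R j + 1)) → ℝ) → (Fin m → ℝ)),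
    IsBackwardFlatParam ψ P₀ y R Fx Fu

/-- The partial derivative `∂_{ζ_{[-1]}} h` at the point `p`. -/
noncomputable def zetaDeriv {n m : ℕ} (h : ShiftSpace n m → ℝ) (p : ShiftSpace n m) :
    (Fin m → ℝ) →L[ℝ] ℝ :=
  fderiv ℝ (fun z : Fin m → ℝ => h (Function.update p.1 0 z, p.2)) (p.1 0)

/-- `ζ_{[-1]}` appears in the function `h` near `P₀`: there is no neighbourhood of `P₀` on which
`∂_{ζ_{[-1]}} h` vanishes identically. -/
def ZetaAppears {n m : ℕ} (P₀ : ShiftSpace n m) (h : ShiftSpace n m → ℝ) : Prop :=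
  ¬ ∀ᶠ p in 𝓝 P₀, zetaDeriv h p = 0

/-- The system `s⁺ = F (s, u)` is static feedback linearizable around the point `(s₀, u₀)`: a local
change of the state coordinates `z = Φ(s)` and a regular static feedback, i.e. an invertible input
transformation `v = V(s, u)`, turn it into a controllable linear system `z⁺ = A z + B v`. -/
def IsStaticFeedbackLinearizableAt {E U : Type*} [NormedAddCommGroup E] [NormedSpace ℝ E]
    [NormedAddCommGroup U] [NormedSpace ℝ U] (F : E × U → E) (s₀ : E) (u₀ : U) : Prop :=
  ∃ (Φ Φinv : E → E) (V Vinv : E × U → U) (A : E →ₗ[ℝ] E) (B : U →ₗ[ℝ] E),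
    LocalDiffeoPair Φ Φinv s₀ ∧
    LocalDiffeoPair (fun q : E × U => (q.1, V q)) (fun q : E × U => (q.1, Vinv q)) (s₀, u₀) ∧
    (⨆ k : ℕ, LinearMap.range ((A ^ k) ∘ₗ B)) = ⊤ ∧
    ∀ᶠ q in 𝓝 (s₀, u₀), Φ (F q) = A (Φ q.1) + B (V q)

/-- The `d`-fold prelongation of `x⁺ = f(x, u)` by a chain of backward shifts that ends in
`gbar(x, u)`. The entry `k` of the first component of the state is `ζ̄^1_{[-(k+1)]}`, hence
`ζ̄^{1,+}_{[-1]} = gbar(x, u)` and `ζ̄^{1,+}_{[-(k+1)]} = ζ̄^1_{[-k]}` for `1 ≤ k < d`. -/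
def prelongation {n m : ℕ} (f : (Fin n → ℝ) × (Fin m → ℝ) → (Fin n → ℝ))
    (gbar : (Fin n → ℝ) × (Fin m → ℝ) → ℝ) (d : ℕ)
    (q : ((Fin d → ℝ) × (Fin n → ℝ)) × (Fin m → ℝ)) : (Fin d → ℝ) × (Fin n → ℝ) :=
  (fun k => if (k : ℕ) = 0 then gbar (q.1.2, q.2)
      else q.1.1 ⟨(k : ℕ) - 1, lt_of_le_of_lt (Nat.sub_le _ _) k.isLt⟩,
    f (q.1.2, q.2))

/-! The backward shifts `z` = y_{[-R,-1]} of the flat output form two chains of integrators of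
lengths `r 0` and `r 1`, driven by the current output `y = φ(x, u)`. Since `∂_u φ` is invertible,
`y` serves as the new input `v`. It remains to see that the state of the prelongation is a change of
coordinates of `z`.

Put `σ = γ₁ - 1` and `d = r 0 - σ`. The shifts of y¹ of orders 1, …, σ are functions of `x` alone,
and that of order `σ + 1` is a function `H(x, ζ_{[-1]})` with nonzero `ζ`-derivative. Take `H` as
the first component of the new variable `ζ̄_{[-1]}`. Then ζ̄¹_{[-k]} is y¹_{[-(σ+k)]}, so the
prelonged state is the image of `z` under `tailAndState`: the last `d` entries of the first chain,
together with `x = F_x(z)`.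

By the inverse function theorem it suffices that the derivative of this map at the equilibrium is
bijective, a question about the linearized system (`IsLinearBackwardFlat`). Let `P` be the
derivative of `F_x`. Injectivity: if `P z = 0`, extend the chains by the output 0; then `x = 0`
forces `u = 0`, and the next state vanishes too. Hence `ker P` is invariant under the chain shift.
If the tail also vanishes, so does the whole first chain, because its first σ entries depend on `x`
only. A nonzero second chain could then be shifted until only its last entry is left, against the
regularity of `∂F_x/∂y²_{[-r_{1,2}]}`. Surjectivity: given `x`, choose `ζ_{[-1]}` so that `H` has
the prescribed linearized value, and repeat at the preceding state. Bijectivity also yields `r 0 + r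
1 = d + n`. Finally `eventually_tailAndState_chain` matches the integrators with the nonlinear
prelongation. -/

/-! ### Local smoothness and local inverses -/

section SmoothNear

variable {E F G : Type*} [NormedAddCommGroup E] [NormedSpace ℝ E]
  [NormedAddCommGroup F] [NormedSpace ℝ F] [NormedAddCommGroup G] [NormedSpace ℝ G]

theorem SmoothNear.contDiffAt {h : E → F} {p : E} (hh : SmoothNear h p) : ContDiffAt ℝ ∞ h p :=
  hh.self_of_nhds

theorem SmoothNear.differentiableAt {h : E → F} {p : E} (hh : SmoothNear h p) :
    DifferentiableAt ℝ h p :=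
  hh.contDiffAt.differentiableAt (by simp)

theorem SmoothNear.continuousAt {h : E → F} {p : E} (hh : SmoothNear h p) : ContinuousAt h p :=
  hh.contDiffAt.continuousAt

theorem ContDiff.smoothNear {h : E → F} (hh : ContDiff ℝ ∞ h) (p : E) : SmoothNear h p :=
  Eventually.of_forall fun _ => hh.contDiffAt

theorem SmoothNear.comp {k : F → G} {h : E → F} {p : E} (hk : SmoothNear k (h p))
    (hh : SmoothNear h p) : SmoothNear (fun z => k (h z)) p := by
  filter_upwards [hh, hh.continuousAt.eventually hk] with z hz hkz
  exact hkz.comp z hz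

theorem SmoothNear.prodMk {h : E → F} {k : E → G} {p : E} (hh : SmoothNear h p)
    (hk : SmoothNear k p) : SmoothNear (fun z => (h z, k z)) p := by
  filter_upwards [hh, hk] with z hz hkz
  exact hz.prodMk hkz

theorem SmoothNear.of_pi {ι : Type*} [Fintype ι] {h : E → ι → ℝ} {p : E}
    (hh : ∀ i, SmoothNear (fun z => h z i) p) : SmoothNear h p := by
  filter_upwards [eventually_all.2 hh] with z hz
  exact contDiffAt_pi.2 hz

theorem SmoothNear.apply {ι : Type*} [Fintype ι] {h : E → ι → ℝ} {p : E}
    (hh : SmoothNear h p) (i : ι) : SmoothNear (fun z => h z i) p := by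
  filter_upwards [hh] with z hz
  exact contDiffAt_pi.1 hz i

theorem LocalDiffeoPair.inv_apply {a : E → F} {b : F → E} {p : E} (h : LocalDiffeoPair a b p) :
    b (a p) = p :=
  h.left_inv.self_of_nhds

theorem LocalDiffeoPair.symm {a : E → F} {b : F → E} {p : E} (h : LocalDiffeoPair a b p) :
    LocalDiffeoPair b a (a p) where
  smooth := h.smooth_inv
  smooth_inv := h.inv_apply.symm ▸ h.smooth
  left_inv := h.right_inv
  right_inv := h.inv_apply.symm ▸ h.left_inv

theorem LocalDiffeoPair.trans {a : E → F} {b : F → E} {a' : F → G} {b' : G → F} {p : E}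
    (h : LocalDiffeoPair a b p) (h' : LocalDiffeoPair a' b' (a p)) :
    LocalDiffeoPair (fun z => a' (a z)) (fun w => b (b' w)) p where
  smooth := h'.smooth.comp h.smooth
  smooth_inv := SmoothNear.comp (k := b) (h'.inv_apply.symm ▸ h.smooth_inv) h'.smooth_inv
  left_inv := by
    filter_upwards [h.left_inv, h.smooth.continuousAt.eventually h'.left_inv] with z hz hz'
    rw [hz', hz]
  right_inv := by
    have hc : Tendsto b' (𝓝 (a' (a p))) (𝓝 (a p)) := by
      simpa [ContinuousAt, h'.inv_apply] using h'.smooth_inv.continuousAt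
    filter_upwards [h'.right_inv, hc.eventually h.right_inv] with w hw hw'
    rw [hw', hw]

theorem ContinuousLinearEquiv.localDiffeoPair (e : E ≃L[ℝ] F) (p : E) :
    LocalDiffeoPair e e.symm p where
  smooth := e.contDiff.smoothNear p
  smooth_inv := e.symm.contDiff.smoothNear _
  left_inv := Eventually.of_forall e.symm_apply_apply
  right_inv := Eventually.of_forall e.apply_symm_apply

/-- The inverse function theorem for maps that are smooth near a point. -/
theorem SmoothNear.exists_localDiffeoPair [FiniteDimensional ℝ E] {a : E → F} {p : E}
    (ha : SmoothNear a p) (hb : Function.Bijective (fderiv ℝ a p)) :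
    ∃ b : F → E, LocalDiffeoPair a b p := by
  have : CompleteSpace E := FiniteDimensional.complete ℝ E
  let e₀ : E ≃ₗ[ℝ] F := LinearEquiv.ofBijective (fderiv ℝ a p).toLinearMap hb
  have : FiniteDimensional ℝ F := e₀.finiteDimensional
  let e : E ≃L[ℝ] F := e₀.toContinuousLinearEquiv
  have he : (e : E →L[ℝ] F) = fderiv ℝ a p := by ext; rfl
  have hd : HasFDerivAt a (e : E →L[ℝ] F) p := he ▸ ha.differentiableAt.hasFDerivAt
  let h := ha.contDiffAt.toOpenPartialHomeomorph a hd (by simp)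
  have hcoe : (h : E → F) = a := rfl
  have hsrc : p ∈ h.source := ha.contDiffAt.mem_toOpenPartialHomeomorph_source hd (by simp)
  have htgt : a p ∈ h.target := h.map_source hsrc
  have hinv : h.symm (a p) = p := h.left_inv hsrc
  have hcont : Tendsto h.symm (𝓝 (a p)) (𝓝 p) := by
    simpa [ContinuousAt, hinv] using h.continuousAt_symm htgt
  have hder : ContinuousAt (fderiv ℝ a) p :=
    (ha.contDiffAt.fderiv_right (m := 0) (by simp)).continuousAt
  -- Invertible derivatives form an open set, so the inverse is smooth on a neighbourhood and not
  -- only at the point `a p`.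
  have hequiv : ∀ᶠ z in 𝓝 p, ∃ e' : E ≃L[ℝ] F, (e' : E →L[ℝ] F) = fderiv ℝ a z :=
    hder.eventually (he ▸ e.nhds)
  refine ⟨h.symm, ha, ?_, ?_, ?_⟩
  · filter_upwards [h.open_target.mem_nhds htgt, hcont.eventually hequiv, hcont.eventually ha]
      with w hw ⟨e', he'⟩ hs
    refine h.contDiffAt_symm (f₀' := e') hw ?_ hs
    rw [he']
    exact (hs.differentiableAt (by simp)).hasFDerivAt
  · filter_upwards [h.open_source.mem_nhds hsrc] with z hz using h.left_inv hz
  · filter_upwards [h.open_target.mem_nhds htgt] with w hw using h.right_inv hw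

/-- A map that is invertible in its second argument defines a local diffeomorphism over the first
factor. -/
theorem SmoothNear.exists_fiberwise_localDiffeoPair [FiniteDimensional ℝ E] [FiniteDimensional ℝ F]
    {h : E × F → G} {p : E × F} (hh : SmoothNear h p)
    (hb : Function.Bijective fun η : F => fderiv ℝ h p (0, η)) :
    ∃ k : E × G → F, LocalDiffeoPair (fun q => (q.1, h q)) (fun q => (q.1, k q)) p := by
  have hs : SmoothNear (fun q : E × F => (q.1, h q)) p :=
    (contDiff_fst.smoothNear p).prodMk hh
  have hd : fderiv ℝ (fun q : E × F => (q.1, h q)) p =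
      (ContinuousLinearMap.fst ℝ E F).prod (fderiv ℝ h p) :=
    (hasFDerivAt_fst.prodMk hh.differentiableAt.hasFDerivAt).fderiv
  have hsplit : ∀ ξ η, fderiv ℝ h p (ξ, η) = fderiv ℝ h p (ξ, 0) + fderiv ℝ h p (0, η) := by
    intro ξ η
    rw [← map_add]; simp
  obtain ⟨b, hbp⟩ := hs.exists_localDiffeoPair (by
    rw [hd]
    constructor
    · rw [injective_iff_map_eq_zero]
      rintro ⟨ξ, η⟩ h0
      simp only [ContinuousLinearMap.prod_apply, ContinuousLinearMap.coe_fst', Prod.mk_eq_zero] at h0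
      obtain ⟨rfl, h0⟩ := h0
      have : η = 0 := hb.1 (h0.trans (map_zero (fderiv ℝ h p)).symm)
      simp [this]
    · rintro ⟨ξ, w⟩
      obtain ⟨η, hη⟩ := hb.2 (w - fderiv ℝ h p (ξ, 0))
      refine ⟨(ξ, η), ?_⟩
      simp only [ContinuousLinearMap.prod_apply, ContinuousLinearMap.coe_fst', Prod.mk.injEq,
        true_and]
      have hη' : fderiv ℝ h p (0, η) = w - fderiv ℝ h p (ξ, 0) := hη
      rw [hsplit, hη']; abel)
  have hfst : ∀ᶠ q in 𝓝 (p.1, h p), b q = (q.1, (b q).2) := by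
    filter_upwards [hbp.right_inv] with q hq
    have hq1 : (b q).1 = q.1 := congrArg Prod.fst hq
    exact Prod.ext hq1 rfl
  refine ⟨fun q => (b q).2, hs, ?_, ?_, ?_⟩
  · exact (contDiff_fst.smoothNear _).prodMk
      (SmoothNear.comp (k := Prod.snd) (contDiff_snd.smoothNear _) hbp.smooth_inv)
  · filter_upwards [hbp.left_inv] with z hz
    rw [hz]
  · filter_upwards [hbp.right_inv, hfst] with q hq hq'
    rw [hq'] at hq
    exact hq

theorem fderiv_comp_prodMk {h : E × F → G} {x : E} {z : F} (hh : DifferentiableAt ℝ h (x, z)) (η : F) :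
    fderiv ℝ (fun w => h (x, w)) z η = fderiv ℝ h (x, z) (0, η) := by
  have h2 := HasFDerivAt.comp (g := h) z hh.hasFDerivAt (hasFDerivAt_prodMk_right x z)
  exact congrArg (fun D => D η) h2.fderiv

end SmoothNear

/-! ### Forward steps and trajectories with prescribed outputs -/

section Forward

variable {n m : ℕ}

/-- The forward shift of a trajectory: `(f, g)` is the inverse of the map `ψ` of the backward
shift, and `u` is the new input. -/
def forwardStep (a : (Fin n → ℝ) × (Fin m → ℝ) → (Fin n → ℝ) × (Fin m → ℝ))
    (u : Fin m → ℝ) (p : ShiftSpace n m) : ShiftSpace n m :=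
  (fun k => Nat.casesOn k (a p.2).2 p.1, ((a p.2).1, u))

theorem backStep_forwardStep
    {a ψ : (Fin n → ℝ) × (Fin m → ℝ) → (Fin n → ℝ) × (Fin m → ℝ)} {u : Fin m → ℝ}
    {p : ShiftSpace n m} (h : ψ (a p.2) = p.2) : backStep ψ (forwardStep a u p) = p := by
  unfold backStep forwardStep
  exact Prod.ext rfl h

theorem backShift_succ {α : Type*} (ψ : (Fin n → ℝ) × (Fin m → ℝ) → (Fin n → ℝ) × (Fin m → ℝ))
    (h : ShiftSpace n m → α) (k : ℕ) (p : ShiftSpace n m) :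
    backShift ψ h (k + 1) p = backShift ψ h k (backStep ψ p) := by
  simp [backShift, Function.iterate_succ_apply]

theorem backShift_succ_forwardStep {α : Type*}
    {a ψ : (Fin n → ℝ) × (Fin m → ℝ) → (Fin n → ℝ) × (Fin m → ℝ)} (h : ShiftSpace n m → α)
    (k : ℕ) {u : Fin m → ℝ} {p : ShiftSpace n m} (hp : ψ (a p.2) = p.2) :
    backShift ψ h (k + 1) (forwardStep a u p) = backShift ψ h k p := by
  rw [backShift_succ, backStep_forwardStep hp]

/-- The shifts of order at least one do not depend on the current input. -/
theorem backShift_succ_update_input {α : Type*}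
    (ψ : (Fin n → ℝ) × (Fin m → ℝ) → (Fin n → ℝ) × (Fin m → ℝ))
    (h : ShiftSpace n m → α) (k : ℕ) (z : ℕ → Fin m → ℝ) (x : Fin n → ℝ) (u u' : Fin m → ℝ) :
    backShift ψ h (k + 1) (z, (x, u)) = backShift ψ h (k + 1) (z, (x, u')) := by
  simp [backShift_succ, backStep]

/-- A trajectory with prescribed outputs: `sol x w` solves the output equation for the input. -/
def trajectoryOf (a : (Fin n → ℝ) × (Fin m → ℝ) → (Fin n → ℝ) × (Fin m → ℝ))
    (sol : (Fin n → ℝ) × (Fin m → ℝ) → (Fin m → ℝ)) (P₀ : ShiftSpace n m) :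
    ℕ → (ℕ → Fin m → ℝ) → ShiftSpace n m
  | 0, _ => P₀
  | N + 1, w =>
    let p := trajectoryOf a sol P₀ N fun k => w (k + 1)
    forwardStep a (sol ((a p.2).1, w 0)) p

variable {a ψ : (Fin n → ℝ) × (Fin m → ℝ) → (Fin n → ℝ) × (Fin m → ℝ)}
  {φ sol : (Fin n → ℝ) × (Fin m → ℝ) → (Fin m → ℝ)} {x₀ : Fin n → ℝ} {u₀ ζ₀ : Fin m → ℝ}

theorem continuousAt_backStep (hψ : ContinuousAt ψ (x₀, ζ₀)) :
    ContinuousAt (backStep ψ) (equilibriumPoint ζ₀ x₀ u₀) := by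
  have h1 : ContinuousAt (fun p : ShiftSpace n m => (p.2.1, p.1 0)) (equilibriumPoint ζ₀ x₀ u₀) :=
    by fun_prop
  have h2 : ContinuousAt (fun p : ShiftSpace n m => ψ (p.2.1, p.1 0))
    (equilibriumPoint ζ₀ x₀ u₀) := ContinuousAt.comp (g := ψ) hψ h1
  have h3 : ContinuousAt (fun (p : ShiftSpace n m) (k : ℕ) => p.1 (k + 1))
    (equilibriumPoint ζ₀ x₀ u₀) := by fun_prop
  exact h3.prodMk h2

theorem backStep_equilibriumPoint (hψ : ψ (x₀, ζ₀) = (x₀, u₀)) :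
    backStep ψ (equilibriumPoint ζ₀ x₀ u₀) = equilibriumPoint ζ₀ x₀ u₀ := by
  simp [backStep, equilibriumPoint, hψ]

theorem iterate_backStep_equilibriumPoint (hψ : ψ (x₀, ζ₀) = (x₀, u₀)) (k : ℕ) :
    (backStep ψ)^[k] (equilibriumPoint ζ₀ x₀ u₀) = equilibriumPoint ζ₀ x₀ u₀ :=
  Function.iterate_fixed (backStep_equilibriumPoint hψ) k

theorem tendsto_backStep (hψ : ContinuousAt ψ (x₀, ζ₀)) (hψ₀ : ψ (x₀, ζ₀) = (x₀, u₀)) :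
    Tendsto (backStep ψ) (𝓝 (equilibriumPoint ζ₀ x₀ u₀)) (𝓝 (equilibriumPoint ζ₀ x₀ u₀)) := by
  have := (continuousAt_backStep (u₀ := u₀) hψ).tendsto
  rwa [backStep_equilibriumPoint hψ₀] at this

theorem tendsto_forwardStep {ι : Type*} {l : Filter ι} {p : ι → ShiftSpace n m}
    {u : ι → Fin m → ℝ} (ha : ContinuousAt a (x₀, u₀)) (ha₀ : a (x₀, u₀) = (x₀, ζ₀))
    (hp : Tendsto p l (𝓝 (equilibriumPoint ζ₀ x₀ u₀))) (hu : Tendsto u l (𝓝 u₀)) :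
    Tendsto (fun i => forwardStep a (u i) (p i)) l (𝓝 (equilibriumPoint ζ₀ x₀ u₀)) := by
  have h1 : Tendsto (fun i => (p i).1) l (𝓝 fun _ => ζ₀) := (continuous_fst.tendsto _).comp hp
  have h2 : Tendsto (fun i => (p i).2) l (𝓝 (x₀, u₀)) := (continuous_snd.tendsto _).comp hp
  have h3 : Tendsto (fun i => a (p i).2) l (𝓝 (x₀, ζ₀)) := by
    have := ha.tendsto.comp h2
    rwa [ha₀] at this
  refine Tendsto.prodMk_nhds (tendsto_pi_nhds.2 fun k => ?_)
    (Tendsto.prodMk_nhds ((continuous_fst.tendsto _).comp h3) hu)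
  cases k with
  | zero => exact (continuous_snd.tendsto _).comp h3
  | succ k => exact tendsto_pi_nhds.1 h1 k

theorem tendsto_trajectoryOf {y₀ : Fin m → ℝ} (ha : ContinuousAt a (x₀, u₀))
    (ha₀ : a (x₀, u₀) = (x₀, ζ₀)) (hsol : ContinuousAt sol (x₀, y₀)) (hsol₀ : sol (x₀, y₀) = u₀)
    (N : ℕ) :
    Tendsto (trajectoryOf a sol (equilibriumPoint ζ₀ x₀ u₀) N) (𝓝 fun _ => y₀)
      (𝓝 (equilibriumPoint ζ₀ x₀ u₀)) := by
  induction N with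
  | zero => exact tendsto_const_nhds
  | succ N ih =>
    have hs : Tendsto (fun (w : ℕ → Fin m → ℝ) k => w (k + 1)) (𝓝 fun _ => y₀)
        (𝓝 fun _ => y₀) := by
      have : Continuous fun (w : ℕ → Fin m → ℝ) (k : ℕ) => w (k + 1) := by fun_prop
      exact this.tendsto _
    have ih' := ih.comp hs
    refine tendsto_forwardStep ha ha₀ ih' ?_
    have h2 := (continuous_snd.tendsto _).comp ih'
    have h3 := (continuous_fst.tendsto _).comp (ha.tendsto.comp h2)
    rw [ha₀] at h3
    have h4 : Tendsto (fun w : ℕ → Fin m → ℝ => w 0) (𝓝 fun _ => y₀) (𝓝 y₀) :=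
      (continuous_apply 0).tendsto _
    have := hsol.tendsto.comp (h3.prodMk_nhds h4)
    rwa [hsol₀] at this

/-- The trajectory runs forward from the equilibrium, choosing each input to produce the required
output; `w 0` is the latest output, so earlier points use the tail of `w`. Closeness of `w` to the
constant sequence keeps the finitely many steps where the local inverses are valid. -/
theorem eventually_backShift_trajectoryOf {y₀ : Fin m → ℝ} (ha : ContinuousAt a (x₀, u₀))
    (ha₀ : a (x₀, u₀) = (x₀, ζ₀)) (hsol : ContinuousAt sol (x₀, y₀)) (hsol₀ : sol (x₀, y₀) = u₀)
    (hψ : ∀ᶠ q in 𝓝 (x₀, u₀), ψ (a q) = q) (hφ : ∀ᶠ q in 𝓝 (x₀, y₀), φ (q.1, sol q) = q.2)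
    (N k : ℕ) (hk : k < N) :
    ∀ᶠ w in 𝓝 fun _ : ℕ => y₀, backShift ψ (fun p => φ p.2) k
      (trajectoryOf a sol (equilibriumPoint ζ₀ x₀ u₀) N w) = w k := by
  induction N generalizing k with
  | zero => omega
  | succ N ih =>
    have hs : Tendsto (fun (w : ℕ → Fin m → ℝ) k => w (k + 1)) (𝓝 fun _ => y₀)
        (𝓝 fun _ => y₀) := by
      have : Continuous fun (w : ℕ → Fin m → ℝ) (k : ℕ) => w (k + 1) := by fun_prop
      exact this.tendsto _
    have ht := (tendsto_trajectoryOf ha ha₀ hsol hsol₀ N).comp hs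
    have h2 := (continuous_snd.tendsto _).comp ht
    cases k with
    | zero =>
      have h3 := (continuous_fst.tendsto _).comp (ha.tendsto.comp h2)
      rw [ha₀] at h3
      have h4 : Tendsto (fun w : ℕ → Fin m → ℝ => w 0) (𝓝 fun _ => y₀) (𝓝 y₀) :=
        (continuous_apply 0).tendsto _
      filter_upwards [(h3.prodMk_nhds h4).eventually hφ] with w hw
      exact hw
    | succ k =>
      filter_upwards [hs.eventually (ih k (by omega)), h2.eventually hψ] with w hw hw'
      rw [← hw]
      exact backShift_succ_forwardStep _ _ hw'

/-- Without a restriction to a neighbourhood, any finite sequence of outputs can be prescribed. -/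
theorem backShift_trajectoryOf (P₀ : ShiftSpace n m) (hψ : ∀ q, ψ (a q) = q)
    (hφ : ∀ q, φ (q.1, sol q) = q.2) (N k : ℕ) (hk : k < N) (w : ℕ → Fin m → ℝ) :
    backShift ψ (fun p => φ p.2) k (trajectoryOf a sol P₀ N w) = w k := by
  induction N generalizing k w with
  | zero => omega
  | succ N ih =>
    cases k with
    | zero => exact hφ ((a (trajectoryOf a sol P₀ N fun k => w (k + 1)).2).1, w 0)
    | succ k =>
      rw [← ih k (by omega) fun k => w (k + 1)]
      exact backShift_succ_forwardStep _ _ (hψ _)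

end Forward

/-! ### Chains of integrators -/

section Chains

variable {ι : Type*} (r : ι → ℕ)

/-- The shift of a family of chains of integrators, where a zero enters each chain. -/
def chainShift : ((Σ j : ι, Fin (r j)) → ℝ) →ₗ[ℝ] ((Σ j : ι, Fin (r j)) → ℝ) where
  toFun z := fun s => if (s.2 : ℕ) = 0 then 0
    else z ⟨s.1, ⟨(s.2 : ℕ) - 1, lt_of_le_of_lt (Nat.sub_le _ _) s.2.isLt⟩⟩
  map_add' z z' := by ext s; simp only [Pi.add_apply]; split_ifs <;> simp
  map_smul' c z := by ext s; simp only [Pi.smul_apply]; split_ifs <;> simp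

/-- The inputs of a family of chains of integrators. -/
def chainInput : (ι → ℝ) →ₗ[ℝ] ((Σ j : ι, Fin (r j)) → ℝ) where
  toFun v := fun s => if (s.2 : ℕ) = 0 then v s.1 else 0
  map_add' z z' := by ext s; simp only [Pi.add_apply]; split_ifs <;> simp
  map_smul' c z := by ext s; simp only [Pi.smul_apply]; split_ifs <;> simp

variable {r}

theorem chainShift_apply (z : (Σ j : ι, Fin (r j)) → ℝ) (s : Σ j : ι, Fin (r j)) :
    chainShift r z s = if (s.2 : ℕ) = 0 then 0
      else z ⟨s.1, ⟨(s.2 : ℕ) - 1, lt_of_le_of_lt (Nat.sub_le _ _) s.2.isLt⟩⟩ := rfl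

theorem chainInput_apply (v : ι → ℝ) (s : Σ j : ι, Fin (r j)) :
    chainInput r v s = if (s.2 : ℕ) = 0 then v s.1 else 0 := rfl

theorem chainShift_pow_apply (l : ℕ) (z : (Σ j : ι, Fin (r j)) → ℝ) (j : ι) (k : Fin (r j)) :
    (chainShift r ^ l) z ⟨j, k⟩ = if (k : ℕ) < l then 0
      else z ⟨j, ⟨(k : ℕ) - l, lt_of_le_of_lt (Nat.sub_le _ _) k.isLt⟩⟩ := by
  induction l generalizing k with
  | zero => simp
  | succ l ih =>
    rw [pow_succ', Module.End.mul_apply, chainShift_apply]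
    by_cases hk : (k : ℕ) = 0
    · simp [hk]
    · simp only [hk, if_false, ih]
      have h1 : ((k : ℕ) - 1 < l) ↔ (k : ℕ) < l + 1 := by omega
      simp only [h1, Nat.sub_sub, Nat.add_comm 1 l]

theorem iSup_range_chainShift_pow_chainInput [Fintype ι] [DecidableEq ι] :
    ⨆ k : ℕ, LinearMap.range ((chainShift r ^ k) ∘ₗ chainInput r) = ⊤ := by
  rw [eq_top_iff]
  rintro z -
  rw [← Finset.univ_sum_single z]
  refine Submodule.sum_mem _ fun s _ => ?_
  obtain ⟨j, k⟩ := s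
  -- An impulse at the input of chain `j` sits at position `k` after `k` shifts.
  refine Submodule.mem_iSup_of_mem (k : ℕ) ⟨Pi.single j (z ⟨j, k⟩), ?_⟩
  ext ⟨j', k'⟩
  rw [LinearMap.comp_apply, chainShift_pow_apply, chainInput_apply]
  by_cases hj : j' = j
  · subst hj
    by_cases hk : k' = k
    · subst hk; simp
    · have hne : (⟨j', k'⟩ : Σ j : ι, Fin (r j)) ≠ ⟨j', k⟩ := by simpa using hk
      have hk' : (k' : ℕ) ≠ k := fun h => hk (Fin.ext h)
      rw [Pi.single_eq_of_ne hne]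
      split_ifs with h1 h2
      · rfl
      · simp only at h2; omega
      · rfl
  · have hne : (⟨j', k'⟩ : Σ j : ι, Fin (r j)) ≠ ⟨j, k⟩ := fun h => hj (congrArg Sigma.fst h)
    rw [Pi.single_eq_of_ne hne]
    simp [hj]

/-- The extension of finite chains, preceded by an entry `v`, to infinite sequences. -/
def chainSequence (v b : ι → ℝ) (z : (Σ j : ι, Fin (r j)) → ℝ) (k : ℕ) (j : ι) : ℝ :=
  if k = 0 then v j else if h : k - 1 < r j then z ⟨j, ⟨k - 1, h⟩⟩ else b j

theorem chainSequence_zero (v b : ι → ℝ) (z : (Σ j : ι, Fin (r j)) → ℝ) :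
    chainSequence v b z 0 = v := by
  ext j; simp [chainSequence]

theorem chainSequence_succ (v b : ι → ℝ) (z : (Σ j : ι, Fin (r j)) → ℝ) (j : ι) (k : Fin (r j)) :
    chainSequence v b z ((k : ℕ) + 1) j = z ⟨j, k⟩ := by
  simp [chainSequence]

theorem chainShift_add_chainInput_apply (v b : ι → ℝ) (z : (Σ j : ι, Fin (r j)) → ℝ)
    (s : Σ j : ι, Fin (r j)) :
    (chainShift r z + chainInput r v) s = chainSequence v b z s.2 s.1 := by
  obtain ⟨j, k⟩ := s
  have hk := lt_of_le_of_lt (Nat.sub_le (k : ℕ) 1) k.isLt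
  by_cases h : (k : ℕ) = 0 <;> simp [chainShift_apply, chainInput_apply, chainSequence, h, hk]

end Chains

/-! ### The map from output chains to the prelonged state -/

section TailAndState

variable {n : ℕ} {r : Fin 2 → ℕ} {σ d : ℕ}

/-- The last `d` entries of the first chain, together with a function of all chains. -/
def tailAndState (hσ : σ + d = r 0) (F : ((Σ j : Fin 2, Fin (r j)) → ℝ) → (Fin n → ℝ))
    (z : (Σ j : Fin 2, Fin (r j)) → ℝ) : (Fin d → ℝ) × (Fin n → ℝ) :=
  (fun k => z ⟨0, ⟨σ + k, by omega⟩⟩, F z)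

end TailAndState

/-! ### The linearized system: bijectivity of the coordinate change -/

section Linear

variable {n : ℕ} {r : Fin 2 → ℕ} {σ d : ℕ}

/-- A linear system with inverse `M` of `(f, g) = J`, with a linear output `C` that parameterizes
the state by its backward shifts. The first shift of the first component of the output that is
not a function of the state is the one of order `σ + 1`. -/
structure IsLinearBackwardFlat
    (M : (Fin n → ℝ) × (Fin 2 → ℝ) →L[ℝ] (Fin n → ℝ) × (Fin 2 → ℝ))
    (J : (Fin n → ℝ) × (Fin 2 → ℝ) →L[ℝ] (Fin n → ℝ) × (Fin 2 → ℝ))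
    (C : (Fin n → ℝ) × (Fin 2 → ℝ) →L[ℝ] (Fin 2 → ℝ))
    (P : ((Σ j : Fin 2, Fin (r j)) → ℝ) →L[ℝ] (Fin n → ℝ))
    (K : (Fin n → ℝ) × (Fin 2 → ℝ) →L[ℝ] ℝ) (σ : ℕ) : Prop where
  left_inv : ∀ q, M (J q) = q
  right_inv : ∀ q, J (M q) = q
  output_bijective : Function.Bijective fun μ => C (0, μ)
  param : ∀ v : ShiftSpace n 2, v.2.1 = P (strictShifts M (fun p => C p.2) r v)
  shift_of_state : ∀ k < σ, ∀ v : ShiftSpace n 2, v.2.1 = 0 →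
    backShift M (fun p => C p.2) (k + 1) v 0 = 0
  first_shift : ∀ v : ShiftSpace n 2,
    backShift M (fun p => C p.2) (σ + 1) v 0 = K (v.2.1, v.1 0)
  first_shift_ne : ∃ η, K (0, η) ≠ 0
  param_ne : ∀ k : Fin (r 1), (k : ℕ) + 1 = r 1 → P (Pi.single ⟨1, k⟩ 1) ≠ 0

namespace IsLinearBackwardFlat

variable {M J : (Fin n → ℝ) × (Fin 2 → ℝ) →L[ℝ] (Fin n → ℝ) × (Fin 2 → ℝ)}
  {C : (Fin n → ℝ) × (Fin 2 → ℝ) →L[ℝ] (Fin 2 → ℝ)}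
  {P : ((Σ j : Fin 2, Fin (r j)) → ℝ) →L[ℝ] (Fin n → ℝ)}
  {K : (Fin n → ℝ) × (Fin 2 → ℝ) →L[ℝ] ℝ}

theorem exists_outputs (h : IsLinearBackwardFlat M J C P K σ) (N : ℕ) (w : ℕ → Fin 2 → ℝ) :
    ∃ v : ShiftSpace n 2, ∀ k < N, backShift M (fun p => C p.2) k v = w k := by
  have hsol : ∀ q : (Fin n → ℝ) × (Fin 2 → ℝ), ∃ μ, C (q.1, μ) = q.2 := by
    rintro ⟨ξ, w⟩
    obtain ⟨μ, hμ⟩ := h.output_bijective.2 (w - C (ξ, 0))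
    refine ⟨μ, ?_⟩
    have hμ' : C (0, μ) = w - C (ξ, 0) := hμ
    have : (ξ, μ) = (ξ, (0 : Fin 2 → ℝ)) + ((0 : Fin n → ℝ), μ) := by simp
    rw [this, map_add, hμ']; abel
  choose sol hsol using hsol
  exact ⟨trajectoryOf J sol 0 N w, fun k hk =>
    backShift_trajectoryOf 0 h.left_inv hsol N k hk w⟩

/-- Chains of outputs, preceded by `0` and continued by `b`, belong to a trajectory. -/
theorem exists_chains (h : IsLinearBackwardFlat M J C P K σ)
    (b : Fin 2 → ℝ) (z : (Σ j : Fin 2, Fin (r j)) → ℝ) (N : ℕ) :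
    ∃ v : ShiftSpace n 2, strictShifts M (fun p => C p.2) r v = z ∧
      ∀ k < N, backShift M (fun p => C p.2) k v = chainSequence 0 b z k := by
  obtain ⟨v, hv⟩ := h.exists_outputs (N + r 0 + r 1 + 1) (chainSequence 0 b z)
  refine ⟨v, ?_, fun k hk => hv k (by omega)⟩
  ext ⟨j, k⟩
  have hj : r j ≤ r 0 + r 1 := by fin_cases j <;> simp
  have := k.isLt
  rw [← chainSequence_succ 0 b z j k, ← hv _ (by omega)]
  rfl

/-- Otherwise the shift of order `r 0 + 1` would vanish whenever the state does; but zero chains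
force the state to be 0 and leave that shift free to be 1. -/
theorem le_order (h : IsLinearBackwardFlat M J C P K σ) : σ ≤ r 0 := by
  by_contra! hlt
  obtain ⟨v, hv, hv'⟩ := h.exists_chains (fun _ => 1) 0 (r 0 + 2)
  have hx : v.2.1 = 0 := by rw [h.param, hv, map_zero]
  have h0 := h.shift_of_state (r 0) hlt v hx
  rw [hv' _ (by omega)] at h0
  simp [chainSequence] at h0

/-- A trajectory with state 0 and current output 0 has input 0, hence next state 0; its chains have
meanwhile been shifted, with a zero entering. -/
theorem param_chainShift (h : IsLinearBackwardFlat M J C P K σ)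
    {z : (Σ j : Fin 2, Fin (r j)) → ℝ} (hz : P z = 0) : P (chainShift r z) = 0 := by
  obtain ⟨v, hv, hv'⟩ := h.exists_chains 0 z (r 0 + r 1 + 1)
  have hx : v.2.1 = 0 := by rw [h.param, hv, hz]
  have hu : v.2.2 = 0 := by
    have h0 := hv' 0 (by omega)
    rw [chainSequence_zero] at h0
    have h0' : C (v.2.1, v.2.2) = 0 := h0
    rw [hx] at h0'
    refine h.output_bijective.1 (h0'.trans ?_)
    exact (map_zero C).symm
  have h2 : v.2 = 0 := Prod.ext hx hu
  have hshift : strictShifts M (fun p => C p.2) r (forwardStep J 0 v) = chainShift r z := by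
    ext ⟨j, k⟩
    have hj : r j ≤ r 0 + r 1 := by fin_cases j <;> simp
    have hk := k.isLt
    have := chainShift_add_chainInput_apply 0 0 z ⟨j, k⟩
    rw [map_zero, add_zero] at this
    rw [this]
    simp only [strictShifts]
    rw [backShift_succ_forwardStep _ _ (h.left_inv _), hv' _ (by omega)]
  rw [← hshift, ← h.param]
  change (J v.2).1 = 0
  rw [h2, map_zero]
  rfl

/-- The kernel of `P` is shift invariant. The first nonzero entry of the second chain can be moved
to the last place, where all other entries are 0, and `param_ne` excludes this. -/
theorem eq_zero_of_param (h : IsLinearBackwardFlat M J C P K σ)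
    {z : (Σ j : Fin 2, Fin (r j)) → ℝ} (hz : P z = 0) (h0 : ∀ k, z ⟨0, k⟩ = 0) : z = 0 := by
  have hpow : ∀ l, P ((chainShift r ^ l) z) = 0 := by
    intro l
    induction l with
    | zero => simpa using hz
    | succ l ih => rw [pow_succ', Module.End.mul_apply]; exact h.param_chainShift ih
  have h1 : ∀ (k : ℕ) (hk : k < r 1), z ⟨1, ⟨k, hk⟩⟩ = 0 := by
    intro k
    induction k using Nat.strong_induction_on with
    | _ k ih =>
      intro hk
      by_contra hne
      -- This many shifts carry position `k` to the last position `r 1 - 1`; what lay behind it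
      -- drops out, what lay before it is 0 by induction.
      have hs : (chainShift r ^ (r 1 - 1 - k)) z =
          z ⟨1, ⟨k, hk⟩⟩ • Pi.single ⟨1, ⟨r 1 - 1, by omega⟩⟩ 1 := by
        ext ⟨j, l⟩
        rw [chainShift_pow_apply]
        fin_cases j
        · simp [h0]
        · obtain ⟨l, hl⟩ := l
          simp only [Fin.mk_one, Fin.isValue] at hl ⊢
          rcases Nat.lt_or_ge l (r 1 - 1) with hl' | hl'
          · have hne' : (⟨1, ⟨l, hl⟩⟩ : Σ j : Fin 2, Fin (r j)) ≠ ⟨1, ⟨r 1 - 1, by omega⟩⟩ := by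
              simp; omega
            rw [Pi.smul_apply, Pi.single_eq_of_ne hne', smul_zero]
            split_ifs with hlt
            · rfl
            · exact ih _ (by omega) _
          · obtain rfl : l = r 1 - 1 := by omega
            rw [if_neg (by omega)]
            have : r 1 - 1 - (r 1 - 1 - k) = k := by omega
            simp [this]
      have := hpow (r 1 - 1 - k)
      rw [hs, map_smul, smul_eq_zero] at this
      exact this.elim hne (h.param_ne _ (by simp only; omega))
  ext ⟨j, k⟩
  fin_cases j
  · exact h0 k
  · exact h1 k k.isLt

theorem tailAndState_injective (h : IsLinearBackwardFlat M J C P K σ) (hσ : σ + d = r 0)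
    {z : (Σ j : Fin 2, Fin (r j)) → ℝ} (hz : tailAndState hσ P z = 0) : z = 0 := by
  have hP : P z = 0 := congrArg Prod.snd hz
  refine h.eq_zero_of_param hP fun k => ?_
  rcases Nat.lt_or_ge k σ with hk | hk
  · obtain ⟨v, hv, hv'⟩ := h.exists_chains 0 z 0
    have hx : v.2.1 = 0 := by rw [h.param, hv, hP]
    rw [← hv]
    exact h.shift_of_state k hk v hx
  · have := congrFun (congrArg Prod.fst hz) ⟨k - σ, by omega⟩
    simp only [tailAndState, Prod.fst_zero, Pi.zero_apply] at this
    refine Eq.trans (congrArg (fun l => z ⟨0, l⟩) (Fin.ext ?_)) this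
    simp only
    omega

/-- The shifts of the first output from order `σ + 1` on can be chosen independently of the
state. -/
theorem exists_state_and_shifts (h : IsLinearBackwardFlat M J C P K σ) (N : ℕ) (b : ℕ → ℝ)
    (ξ : Fin n → ℝ) : ∃ v : ShiftSpace n 2, v.2.1 = ξ ∧
      ∀ k < N, backShift M (fun p => C p.2) (σ + k + 1) v 0 = b k := by
  induction N generalizing b ξ with
  | zero => exact ⟨(0, (ξ, 0)), rfl, by simp⟩
  | succ N ih =>
    obtain ⟨η₁, hη₁⟩ := h.first_shift_ne
    -- Solves the affine equation `K (ξ, c • η₁) = b 0`; the remaining values are then assigned by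
    -- induction at the preceding state.
    let c := (b 0 - K (ξ, 0)) / K (0, η₁)
    have hη : K (ξ, c • η₁) = b 0 := by
      have : (ξ, c • η₁) = (ξ, (0 : Fin 2 → ℝ)) + c • ((0 : Fin n → ℝ), η₁) := by simp
      rw [this, map_add, map_smul, smul_eq_mul, div_mul_cancel₀ _ hη₁]; ring
    obtain ⟨v, hv, hv'⟩ := ih (fun k => b (k + 1)) (M (ξ, c • η₁)).1
    refine ⟨(fun k => Nat.casesOn k (c • η₁) v.1, (ξ, 0)), rfl, fun k hk => ?_⟩
    cases k with
    | zero => rw [add_zero, h.first_shift]; exact hη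
    | succ k =>
      rw [← hv' k (by omega), backShift_succ]
      have : σ + (k + 1) = σ + k + 1 := by omega
      rw [this]
      -- The backward step gives the input dictated by `M`, not that of `v`; shifts of positive
      -- order do not see the difference.
      refine (congrFun (backShift_succ_update_input _ _ _ v.1 _ _ v.2.2) 0).trans ?_
      have hvv : (v.1, ((M (ξ, c • η₁)).1, v.2.2)) = v := by rw [← hv]
      exact congrArg (fun v => backShift M (fun p => C p.2) (σ + k + 1) v 0) hvv

theorem tailAndState_surjective (h : IsLinearBackwardFlat M J C P K σ) (hσ : σ + d = r 0) :
    Function.Surjective (tailAndState hσ P) := by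
  rintro ⟨b, ξ⟩
  obtain ⟨v, hv, hv'⟩ := h.exists_state_and_shifts d (fun k => if h : k < d then b ⟨k, h⟩ else 0) ξ
  refine ⟨strictShifts M (fun p => C p.2) r v, Prod.ext ?_ ?_⟩
  · ext k
    refine (hv' k k.isLt).trans ?_
    simp
  · exact (h.param v).symm.trans hv

end IsLinearBackwardFlat

end Linear

/-! ### Differentiating the backward shifts at the equilibrium -/

section Linearization

variable {n m : ℕ} {ψ : (Fin n → ℝ) × (Fin m → ℝ) → (Fin n → ℝ) × (Fin m → ℝ)}
  {M : (Fin n → ℝ) × (Fin m → ℝ) →L[ℝ] (Fin n → ℝ) × (Fin m → ℝ)}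
  {φ : (Fin n → ℝ) × (Fin m → ℝ) → (Fin m → ℝ)}
  {C : (Fin n → ℝ) × (Fin m → ℝ) →L[ℝ] (Fin m → ℝ)}
  {x₀ : Fin n → ℝ} {u₀ ζ₀ : Fin m → ℝ}

theorem tendsto_add_smul (p v : ShiftSpace n m) :
    Tendsto (fun t : ℝ => p + t • v) (𝓝 0) (𝓝 p) := by
  have h : Continuous fun t : ℝ => p + t • v := by fun_prop
  simpa using h.tendsto 0

/-- The sequence space carries only the product topology, so derivatives are taken along lines and
coordinate by coordinate. The equilibrium is fixed by the backward step, so the same `M` appears in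
every iteration. -/
theorem hasDerivAt_iterate_backStep (hM : HasFDerivAt ψ M (x₀, ζ₀)) (hψ : ψ (x₀, ζ₀) = (x₀, u₀))
    (v : ShiftSpace n m) (k : ℕ) :
    (∀ i, HasDerivAt
      (fun t : ℝ => ((backStep ψ)^[k] (equilibriumPoint ζ₀ x₀ u₀ + t • v)).1 i)
      (((backStep M)^[k] v).1 i) 0) ∧
    HasDerivAt (fun t : ℝ => ((backStep ψ)^[k] (equilibriumPoint ζ₀ x₀ u₀ + t • v)).2)
      ((backStep M)^[k] v).2 0 := by
  induction k with
  | zero =>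
    constructor
    · intro i
      simpa using ((hasDerivAt_id (0 : ℝ)).smul_const (v.1 i)).const_add ζ₀
    · simpa [equilibriumPoint] using ((hasDerivAt_id (0 : ℝ)).smul_const v.2).const_add (x₀, u₀)
  | succ k ih =>
    simp only [Function.iterate_succ_apply']
    refine ⟨fun i => ih.1 (i + 1), ?_⟩
    have hx : HasDerivAt
        (fun t : ℝ => ((backStep ψ)^[k] (equilibriumPoint ζ₀ x₀ u₀ + t • v)).2.1)
        ((backStep M)^[k] v).2.1 0 :=
      HasFDerivAt.comp_hasDerivAt (l := Prod.fst)
        (l' := ContinuousLinearMap.fst ℝ (Fin n → ℝ) (Fin m → ℝ)) (0 : ℝ) hasFDerivAt_fst ih.2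
    refine HasFDerivAt.comp_hasDerivAt (l := ψ) (0 : ℝ) ?_ (hx.prodMk (ih.1 0))
    simp only [zero_smul, add_zero, iterate_backStep_equilibriumPoint hψ]
    exact hM

theorem hasDerivAt_backShift (hM : HasFDerivAt ψ M (x₀, ζ₀)) (hψ : ψ (x₀, ζ₀) = (x₀, u₀))
    (hC : HasFDerivAt φ C (x₀, u₀)) (v : ShiftSpace n m) (k : ℕ) :
    HasDerivAt (fun t : ℝ => backShift ψ (fun p => φ p.2) k (equilibriumPoint ζ₀ x₀ u₀ + t • v))
      (backShift M (fun p => C p.2) k v) 0 := by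
  refine HasFDerivAt.comp_hasDerivAt (l := φ) (0 : ℝ) ?_ (hasDerivAt_iterate_backStep hM hψ v k).2
  simp only [zero_smul, add_zero, iterate_backStep_equilibriumPoint hψ]
  exact hC

theorem hasDerivAt_strictShifts (hM : HasFDerivAt ψ M (x₀, ζ₀)) (hψ : ψ (x₀, ζ₀) = (x₀, u₀))
    (hC : HasFDerivAt φ C (x₀, u₀)) (r : Fin m → ℕ) (v : ShiftSpace n m) :
    HasDerivAt
      (fun t : ℝ => strictShifts ψ (fun p => φ p.2) r (equilibriumPoint ζ₀ x₀ u₀ + t • v))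
      (strictShifts M (fun p => C p.2) r v) 0 :=
  hasDerivAt_pi.2 fun s => hasDerivAt_pi.1 (hasDerivAt_backShift hM hψ hC v ((s.2 : ℕ) + 1)) s.1

theorem tangent_state_eq (hM : HasFDerivAt ψ M (x₀, ζ₀)) (hψ : ψ (x₀, ζ₀) = (x₀, u₀))
    (hC : HasFDerivAt φ C (x₀, u₀)) {r : Fin m → ℕ}
    {F : ((Σ j : Fin m, Fin (r j)) → ℝ) → (Fin n → ℝ)}
    {P : ((Σ j : Fin m, Fin (r j)) → ℝ) →L[ℝ] (Fin n → ℝ)}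
    (hP : HasFDerivAt F P (strictShifts ψ (fun p => φ p.2) r (equilibriumPoint ζ₀ x₀ u₀)))
    (hF : ∀ᶠ p in 𝓝 (equilibriumPoint ζ₀ x₀ u₀),
      p.2.1 = F (strictShifts ψ (fun p => φ p.2) r p)) (v : ShiftSpace n m) :
    v.2.1 = P (strictShifts M (fun p => C p.2) r v) := by
  have h1 : HasDerivAt (fun t : ℝ => (equilibriumPoint ζ₀ x₀ u₀ + t • v).2.1) v.2.1 0 := by
    simpa [equilibriumPoint] using ((hasDerivAt_id (0 : ℝ)).smul_const v.2.1).const_add x₀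
  have h2 := HasFDerivAt.comp_hasDerivAt (l := F) (0 : ℝ) (by simpa using hP)
    (hasDerivAt_strictShifts hM hψ hC r v)
  exact h1.unique (h2.congr_of_eventuallyEq ((tendsto_add_smul _ v).eventually hF))

theorem tangent_shift_eq (hM : HasFDerivAt ψ M (x₀, ζ₀)) (hψ : ψ (x₀, ζ₀) = (x₀, u₀))
    (hC : HasFDerivAt φ C (x₀, u₀)) {k : ℕ} {j : Fin m}
    {H : (Fin n → ℝ) × (Fin m → ℝ) → ℝ} {K : (Fin n → ℝ) × (Fin m → ℝ) →L[ℝ] ℝ}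
    (hK : HasFDerivAt H K (x₀, ζ₀))
    (hH : ∀ᶠ p in 𝓝 (equilibriumPoint ζ₀ x₀ u₀),
      backShift ψ (fun p => φ p.2) k p j = H (p.2.1, p.1 0)) (v : ShiftSpace n m) :
    backShift M (fun p => C p.2) k v j = K (v.2.1, v.1 0) := by
  have h1 := hasDerivAt_pi.1 (hasDerivAt_backShift hM hψ hC v k) j
  have h2 : HasDerivAt (fun t : ℝ => ((equilibriumPoint ζ₀ x₀ u₀ + t • v).2.1,
      (equilibriumPoint ζ₀ x₀ u₀ + t • v).1 0)) (v.2.1, v.1 0) 0 := by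
    simpa [equilibriumPoint] using
      ((hasDerivAt_id (0 : ℝ)).smul_const (v.2.1, v.1 0)).const_add (x₀, ζ₀)
  have h3 := HasFDerivAt.comp_hasDerivAt (l := H) (0 : ℝ)
    (by simpa [equilibriumPoint] using hK) h2
  exact h1.unique (h3.congr_of_eventuallyEq ((tendsto_add_smul _ v).eventually hH))

end Linearization

/-! ### Dependence of the shifts on `ζ_{[-1]}` -/

section ZetaDependence

variable {n m : ℕ} {ψ : (Fin n → ℝ) × (Fin m → ℝ) → (Fin n → ℝ) × (Fin m → ℝ)}
  {φ : (Fin n → ℝ) × (Fin m → ℝ) → (Fin m → ℝ)} {x₀ : Fin n → ℝ} {u₀ ζ₀ : Fin m → ℝ}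

theorem eventually_zetaDeriv_eq {P₀ : ShiftSpace n m} {h : ShiftSpace n m → ℝ}
    {H : (Fin n → ℝ) × (Fin m → ℝ) → ℝ} (hH : ∀ᶠ p in 𝓝 P₀, h p = H (p.2.1, p.1 0)) :
    ∀ᶠ p in 𝓝 P₀, zetaDeriv h p = fderiv ℝ (fun z => H (p.2.1, z)) (p.1 0) := by
  filter_upwards [eventually_eventually_nhds.2 hH] with p hp
  refine Filter.EventuallyEq.fderiv_eq ?_
  have hc : Continuous fun z : Fin m → ℝ => ((Function.update p.1 0 z, p.2) : ShiftSpace n m) := by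
    fun_prop
  have ht := hc.tendsto (p.1 0)
  rw [Function.update_eq_self] at ht
  filter_upwards [ht.eventually hp] with z hz
  simpa using hz

theorem eventually_pair_of_shiftSpace {S : (Fin n → ℝ) × (Fin m → ℝ) → Prop}
    (h : ∀ᶠ p in 𝓝 (equilibriumPoint ζ₀ x₀ u₀), S (p.2.1, p.1 0)) :
    ∀ᶠ q in 𝓝 (x₀, ζ₀), S q := by
  have hc : Continuous fun q : (Fin n → ℝ) × (Fin m → ℝ) =>
      (((fun _ => q.2), (q.1, u₀)) : ShiftSpace n m) := by fun_prop
  exact (hc.tendsto (x₀, ζ₀)).eventually h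

theorem tendsto_pair_of_shiftSpace :
    Tendsto (fun p : ShiftSpace n m => (p.2.1, p.1 0)) (𝓝 (equilibriumPoint ζ₀ x₀ u₀))
      (𝓝 (x₀, ζ₀)) := by
  have hc : Continuous fun p : ShiftSpace n m => (p.2.1, p.1 0) := by fun_prop
  exact hc.tendsto _

/-- A ball for the sup norm is a product of balls, so each slice in the second variable is connected
and contains `z`. -/
theorem SmoothNear.eventually_eq_of_fderiv_snd_eq_zero {E F : Type*} [NormedAddCommGroup E]
    [NormedSpace ℝ E] [NormedAddCommGroup F] [NormedSpace ℝ F] {H : E × F → ℝ} {x : E} {z : F}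
    (hH : SmoothNear H (x, z)) (h0 : ∀ᶠ q in 𝓝 (x, z), fderiv ℝ (fun w => H (q.1, w)) q.2 = 0) :
    ∀ᶠ q in 𝓝 (x, z), H q = H (q.1, z) := by
  obtain ⟨ε, hε, hball⟩ := Metric.eventually_nhds_iff_ball.1 (hH.and h0)
  filter_upwards [Metric.ball_mem_nhds (x, z) hε] with q hq
  rw [← ball_prod_same] at hq hball
  refine IsOpen.is_const_of_fderiv_eq_zero (𝕜 := ℝ) (f := fun w => H (q.1, w))
    (s := Metric.ball z ε) Metric.isOpen_ball (convex_ball z ε).isPreconnected ?_ ?_ hq.2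
    (Metric.mem_ball_self hε)
  · intro w hw
    have hd : DifferentiableAt ℝ H (q.1, w) := (hball (q.1, w) ⟨hq.1, hw⟩).1.differentiableAt
      (by simp)
    have hp : DifferentiableAt ℝ (fun w => (q.1, w)) w := by fun_prop
    exact (hd.comp w hp).differentiableWithinAt
  · intro w hw
    exact (hball (q.1, w) ⟨hq.1, hw⟩).2

/-- If `ζ_{[-1]}` does not appear in the shifts of orders `1, …, k`, then the shift of order
`k + 1` is a function of `x` and `ζ_{[-1]}`. -/
theorem exists_backShift_eq (hψ : SmoothNear ψ (x₀, ζ₀)) (hψ₀ : ψ (x₀, ζ₀) = (x₀, u₀))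
    (hφ : SmoothNear φ (x₀, u₀)) (j : Fin m) (k : ℕ)
    (hk : ∀ i, 1 ≤ i → i ≤ k → ¬ ZetaAppears (equilibriumPoint ζ₀ x₀ u₀)
      fun p => backShift ψ (fun p => φ p.2) i p j) :
    ∃ H : (Fin n → ℝ) × (Fin m → ℝ) → ℝ, SmoothNear H (x₀, ζ₀) ∧
      ∀ᶠ p in 𝓝 (equilibriumPoint ζ₀ x₀ u₀),
        backShift ψ (fun p => φ p.2) (k + 1) p j = H (p.2.1, p.1 0) := by
  induction k with
  | zero =>
    refine ⟨fun q => φ (ψ q) j, ?_, Eventually.of_forall fun p => rfl⟩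
    exact (SmoothNear.comp (hψ₀.symm ▸ hφ) hψ).apply j
  | succ k ih =>
    obtain ⟨H, hH, hHp⟩ := ih fun i h1 h2 => hk i h1 (by omega)
    have h0 := not_not.1 (hk (k + 1) (by omega) le_rfl)
    have hz : ∀ᶠ q in 𝓝 (x₀, ζ₀), fderiv ℝ (fun w => H (q.1, w)) q.2 = 0 := by
      refine eventually_pair_of_shiftSpace (u₀ := u₀) ?_
      filter_upwards [h0, eventually_zetaDeriv_eq hHp] with p hp hp'
      rw [← hp', hp]
    have hconst := hH.eventually_eq_of_fderiv_snd_eq_zero hz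
    -- The current shift does not depend on `ζ_{[-1]}`, so this argument may be frozen at `ζ₀`; a
    -- further backward step replaces `x` by `ψ_x(x, ζ_{[-1]})`.
    refine ⟨fun q => H ((ψ q).1, ζ₀), ?_, ?_⟩
    · refine SmoothNear.comp (k := fun ξ => H (ξ, ζ₀)) (h := fun q => (ψ q).1) ?_ ?_
      · rw [hψ₀]
        exact SmoothNear.comp (k := H) (h := fun ξ => (ξ, ζ₀)) hH ((contDiff_id.prodMk contDiff_const).smoothNear x₀)
      · exact SmoothNear.comp (k := Prod.fst) (contDiff_fst.smoothNear _) hψ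
    · have ht := tendsto_backStep (u₀ := u₀) hψ.continuousAt hψ₀
      filter_upwards [ht.eventually hHp,
        ht.eventually (tendsto_pair_of_shiftSpace.eventually hconst)] with p hp hp'
      rw [backShift_succ, hp, hp']
      rfl

theorem zetaDeriv_equilibriumPoint {h : ShiftSpace n m → ℝ}
    {H : (Fin n → ℝ) × (Fin m → ℝ) → ℝ} (hs : SmoothNear H (x₀, ζ₀))
    (hH : ∀ᶠ p in 𝓝 (equilibriumPoint ζ₀ x₀ u₀), h p = H (p.2.1, p.1 0)) (η : Fin m → ℝ) :
    zetaDeriv h (equilibriumPoint ζ₀ x₀ u₀) η = fderiv ℝ H (x₀, ζ₀) (0, η) := by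
  rw [(eventually_zetaDeriv_eq hH).self_of_nhds]
  exact fderiv_comp_prodMk hs.differentiableAt η

end ZetaDependence

/-! ### The new variable `ζ̄` and the conjugation with the prelongation -/

section Assembly

theorem bijective_of_jacobianRank_eq {m : ℕ} {D : (Fin m → ℝ) →L[ℝ] (Fin m → ℝ)}
    (h : jacobianRank D = m) : Function.Bijective D := by
  have hs : Function.Surjective D.toLinearMap := by
    rw [← LinearMap.range_eq_top]
    exact Submodule.eq_top_of_finrank_eq (h.trans (by simp))
  exact ⟨LinearMap.injective_iff_surjective.2 hs, hs⟩

/-- A function whose derivative in the direction of `ζ` does not vanish can be completed to a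
transformation of `ζ`. -/
theorem SmoothNear.exists_completion {E : Type*} [NormedAddCommGroup E] [NormedSpace ℝ E]
    [FiniteDimensional ℝ E] {H : E × (Fin 2 → ℝ) → ℝ} {p : E × (Fin 2 → ℝ)}
    (hH : SmoothNear H p) (hne : ∃ η, fderiv ℝ H p (0, η) ≠ 0) :
    ∃ T Φ : E × (Fin 2 → ℝ) → (Fin 2 → ℝ),
      LocalDiffeoPair (fun q => (q.1, T q)) (fun q => (q.1, Φ q)) p ∧ ∀ q, T q 0 = H q := by
  obtain ⟨i, hi⟩ : ∃ i, fderiv ℝ H p (0, Pi.single i 1) ≠ 0 := by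
    by_contra! hall
    obtain ⟨η, hη⟩ := hne
    apply hη
    have : ((0 : E), η) = η 0 • (0, Pi.single 0 1) + η 1 • (0, Pi.single 1 1) := by
      refine Prod.ext (by simp) ?_
      ext j
      fin_cases j <;> simp
    rw [this, map_add, map_smul, map_smul, hall, hall]
    simp
  have hproj : SmoothNear (fun q : E × (Fin 2 → ℝ) => q.2 (i + 1)) p :=
    ContDiff.smoothNear (by fun_prop) p
  -- `H` replaces the coordinate `i` on which it depends; in `Fin 2` the index `i + 1` is the other
  -- one, which is kept.
  have hT : SmoothNear (fun q : E × (Fin 2 → ℝ) => ![H q, q.2 (i + 1)]) p := by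
    refine SmoothNear.of_pi fun j => ?_
    fin_cases j
    · exact hH
    · exact hproj
  have hd : ∀ η, fderiv ℝ (fun q : E × (Fin 2 → ℝ) => ![H q, q.2 (i + 1)]) p (0, η) =
      ![fderiv ℝ H p (0, η), η (i + 1)] := by
    intro η
    have h0 := hasFDerivAt_pi'.1 hT.differentiableAt.hasFDerivAt
    ext j
    fin_cases j
    · exact congrArg (fun D => D (0, η)) ((h0 0).unique hH.differentiableAt.hasFDerivAt)
    · have h2 : HasFDerivAt (fun q : E × (Fin 2 → ℝ) => q.2 (i + 1))
          ((ContinuousLinearMap.proj (R := ℝ) (φ := fun _ : Fin 2 => ℝ) (i + 1)).comp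
            (ContinuousLinearMap.snd ℝ E (Fin 2 → ℝ))) p :=
        ((ContinuousLinearMap.proj (R := ℝ) (φ := fun _ : Fin 2 => ℝ) (i + 1)).comp
          (ContinuousLinearMap.snd ℝ E (Fin 2 → ℝ))).hasFDerivAt
      exact congrArg (fun D => D (0, η)) ((h0 1).unique h2)
  obtain ⟨Φ, hΦ⟩ := hT.exists_fiberwise_localDiffeoPair (by
    let L : (Fin 2 → ℝ) →ₗ[ℝ] (Fin 2 → ℝ) :=
      (fderiv ℝ (fun q : E × (Fin 2 → ℝ) => ![H q, q.2 (i + 1)]) p).toLinearMap ∘ₗ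
        LinearMap.inr ℝ E (Fin 2 → ℝ)
    have hL : Function.Injective L := by
      rw [injective_iff_map_eq_zero]
      intro η hη
      have hη' : ![fderiv ℝ H p (0, η), η (i + 1)] = 0 := (hd η).symm.trans hη
      have h0 : fderiv ℝ H p (0, η) = 0 := congrFun hη' 0
      have h1 : η (i + 1) = 0 := congrFun hη' 1
      have hs : η = η i • Pi.single i 1 := by
        ext j
        by_cases hj : j = i
        · subst hj; simp
        · obtain rfl : j = i + 1 := by omega
          simp [h1, hj]
      have hs' : ((0 : E), η) = η i • (0, Pi.single i 1) :=
        Prod.ext (by simp) (by simpa using hs)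
      rw [hs', map_smul, smul_eq_mul, mul_eq_zero] at h0
      rw [hs, h0.resolve_right hi, zero_smul]
    exact ⟨hL, LinearMap.injective_iff_surjective.1 hL⟩)
  exact ⟨_, Φ, hΦ, fun q => rfl⟩

variable {n : ℕ} {f : (Fin n → ℝ) × (Fin 2 → ℝ) → (Fin n → ℝ)}
  {g φ : (Fin n → ℝ) × (Fin 2 → ℝ) → (Fin 2 → ℝ)}
  {ψ : (Fin n → ℝ) × (Fin 2 → ℝ) → (Fin n → ℝ) × (Fin 2 → ℝ)}
  {x₀ : Fin n → ℝ} {u₀ : Fin 2 → ℝ} {r : Fin 2 → ℕ}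
  {Fx : ((Σ j : Fin 2, Fin (r j)) → ℝ) → (Fin n → ℝ)}
  {H : (Fin n → ℝ) × (Fin 2 → ℝ) → ℝ} {σ d : ℕ}

theorem strictShifts_equilibriumPoint {m : ℕ} {ζ₀ u₀ : Fin m → ℝ} {r : Fin m → ℕ}
    {φ : (Fin n → ℝ) × (Fin m → ℝ) → (Fin m → ℝ)}
    {ψ : (Fin n → ℝ) × (Fin m → ℝ) → (Fin n → ℝ) × (Fin m → ℝ)}
    (hψ₀ : ψ (x₀, ζ₀) = (x₀, u₀)) :
    strictShifts ψ (fun p => φ p.2) r (equilibriumPoint ζ₀ x₀ u₀) =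
      fun s => φ (x₀, u₀) s.1 := by
  ext s
  simp only [strictShifts, backShift, iterate_backStep_equilibriumPoint hψ₀]
  rfl

theorem LocalDiffeoPair.fderiv_comp_fderiv {E F : Type*} [NormedAddCommGroup E] [NormedSpace ℝ E]
    [NormedAddCommGroup F] [NormedSpace ℝ F] {a : E → F} {b : F → E} {p : E}
    (h : LocalDiffeoPair a b p) (v : E) : fderiv ℝ b (a p) (fderiv ℝ a p v) = v := by
  have h1 := h.smooth_inv.differentiableAt.hasFDerivAt.comp p h.smooth.differentiableAt.hasFDerivAt
  have h2 : HasFDerivAt (b ∘ a) (ContinuousLinearMap.id ℝ E) p :=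
    (hasFDerivAt_id p).congr_of_eventuallyEq h.left_inv
  exact congrArg (fun D => D v) (h1.unique h2)

theorem isLinearBackwardFlat_fderiv {ζ₀ : Fin 2 → ℝ}
    (hψ : LocalDiffeoPair (fun p => (f p, g p)) ψ (x₀, u₀))
    (heq : (f (x₀, u₀), g (x₀, u₀)) = (x₀, ζ₀)) (hφ : SmoothNear φ (x₀, u₀))
    (hφu : Function.Bijective fun μ => fderiv ℝ φ (x₀, u₀) (0, μ))
    (hFs : SmoothNear Fx fun s => φ (x₀, u₀) s.1)
    (hF : ∀ᶠ p in 𝓝 (equilibriumPoint ζ₀ x₀ u₀),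
      p.2.1 = Fx (strictShifts ψ (fun p => φ p.2) r p))
    (hσ : ∀ k < σ, ¬ ZetaAppears (equilibriumPoint ζ₀ x₀ u₀)
      fun p => backShift ψ (fun p => φ p.2) (k + 1) p 0)
    (hHs : SmoothNear H (x₀, ζ₀))
    (hH : ∀ᶠ p in 𝓝 (equilibriumPoint ζ₀ x₀ u₀),
      backShift ψ (fun p => φ p.2) (σ + 1) p 0 = H (p.2.1, p.1 0))
    (hne : ∃ η, fderiv ℝ H (x₀, ζ₀) (0, η) ≠ 0)
    (hreg : ∀ k : Fin (r 1), (k : ℕ) + 1 = r 1 →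
      fderiv ℝ Fx (fun s => φ (x₀, u₀) s.1) (Pi.single ⟨1, k⟩ 1) ≠ 0) :
    IsLinearBackwardFlat (fderiv ℝ ψ (x₀, ζ₀)) (fderiv ℝ (fun p => (f p, g p)) (x₀, u₀))
      (fderiv ℝ φ (x₀, u₀)) (fderiv ℝ Fx fun s => φ (x₀, u₀) s.1) (fderiv ℝ H (x₀, ζ₀)) σ := by
  have hψ₀ : ψ (x₀, ζ₀) = (x₀, u₀) := heq ▸ hψ.inv_apply
  have hψs : SmoothNear ψ (x₀, ζ₀) := heq ▸ hψ.smooth_inv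
  have hM := hψs.differentiableAt.hasFDerivAt
  have hC := hφ.differentiableAt.hasFDerivAt
  refine ⟨?_, ?_, hφu, ?_, ?_, ?_, hne, hreg⟩
  · intro q
    have := hψ.fderiv_comp_fderiv q
    rwa [heq] at this
  · intro q
    have := hψ.symm.fderiv_comp_fderiv q
    rwa [heq, hψ₀] at this
  · refine tangent_state_eq hM hψ₀ hC ?_ hF
    rw [strictShifts_equilibriumPoint hψ₀]
    exact hFs.differentiableAt.hasFDerivAt
  · intro k hk v hv
    obtain ⟨H', hH's, hH'⟩ := exists_backShift_eq hψs hψ₀ hφ 0 k fun i h1 h2 => by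
      obtain ⟨i, rfl⟩ : ∃ i', i = i' + 1 := ⟨i - 1, by omega⟩
      exact hσ i (by omega)
    rw [tangent_shift_eq hM hψ₀ hC hH's.differentiableAt.hasFDerivAt hH', hv,
      ← zetaDeriv_equilibriumPoint hH's hH', (not_not.1 (hσ k hk)).self_of_nhds]
    rfl
  · exact tangent_shift_eq hM hψ₀ hC hHs.differentiableAt.hasFDerivAt hH

/-- The chains of outputs evolve like integrators, and this corresponds to the dynamics of the
prelonged system. -/
theorem eventually_tailAndState_chain {ζ₀ : Fin 2 → ℝ}
    (hψ : LocalDiffeoPair (fun p => (f p, g p)) ψ (x₀, u₀))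
    (heq : (f (x₀, u₀), g (x₀, u₀)) = (x₀, ζ₀)) (hφ : SmoothNear φ (x₀, u₀))
    (hφu : Function.Bijective fun μ => fderiv ℝ φ (x₀, u₀) (0, μ))
    (hFs : SmoothNear Fx fun s => φ (x₀, u₀) s.1)
    (hF : ∀ᶠ p in 𝓝 (equilibriumPoint ζ₀ x₀ u₀),
      p.2.1 = Fx (strictShifts ψ (fun p => φ p.2) r p))
    (hF₀ : Fx (fun s => φ (x₀, u₀) s.1) = x₀)
    (hH : ∀ᶠ p in 𝓝 (equilibriumPoint ζ₀ x₀ u₀),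
      backShift ψ (fun p => φ p.2) (σ + 1) p 0 = H (p.2.1, p.1 0))
    (hσ : σ + d = r 0) :
    ∀ᶠ q in 𝓝 ((fun s : Σ j : Fin 2, Fin (r j) => φ (x₀, u₀) s.1), u₀),
      tailAndState hσ Fx (chainShift r q.1 + chainInput r (φ (Fx q.1, q.2))) =
        prelongation f (fun p => H (f p, g p)) d (tailAndState hσ Fx q.1, q.2) := by
  set z₀ : (Σ j : Fin 2, Fin (r j)) → ℝ := fun s => φ (x₀, u₀) s.1
  set y₀ := φ (x₀, u₀)
  have hψ₀ : ψ (x₀, ζ₀) = (x₀, u₀) := heq ▸ hψ.inv_apply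
  obtain ⟨sol, hsol⟩ := hφ.exists_fiberwise_localDiffeoPair hφu
  have hsol₀ : sol (x₀, y₀) = u₀ := congrArg Prod.snd hsol.inv_apply
  have hsolc : ContinuousAt sol (x₀, y₀) := continuousAt_snd.comp hsol.smooth_inv.continuousAt
  have hsolφ : ∀ᶠ q in 𝓝 (x₀, y₀), φ (q.1, sol q) = q.2 :=
    hsol.right_inv.mono fun q hq => congrArg Prod.snd hq
  have hac := hψ.smooth.continuousAt
  -- The outputs to prescribe: the current one belongs to `(F_x(z), u)`, the past ones are the
  -- chains `z`, and all older ones are at equilibrium.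
  let w : ((Σ j : Fin 2, Fin (r j)) → ℝ) × (Fin 2 → ℝ) → ℕ → Fin 2 → ℝ :=
    fun q => chainSequence (φ (Fx q.1, q.2)) y₀ q.1
  have hxu : Tendsto (fun q : ((Σ j : Fin 2, Fin (r j)) → ℝ) × (Fin 2 → ℝ) => (Fx q.1, q.2))
      (𝓝 (z₀, u₀)) (𝓝 (x₀, u₀)) := by
    have h1 : Tendsto (fun q : ((Σ j : Fin 2, Fin (r j)) → ℝ) × (Fin 2 → ℝ) => Fx q.1)
        (𝓝 (z₀, u₀)) (𝓝 (Fx z₀)) := hFs.continuousAt.tendsto.comp (continuous_fst.tendsto _)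
    rw [hF₀] at h1
    exact h1.prodMk_nhds (continuous_snd.tendsto (z₀, u₀))
  have hv : Tendsto (fun q : ((Σ j : Fin 2, Fin (r j)) → ℝ) × (Fin 2 → ℝ) => φ (Fx q.1, q.2))
      (𝓝 (z₀, u₀)) (𝓝 y₀) := hφ.continuousAt.tendsto.comp hxu
  have hw : Tendsto w (𝓝 (z₀, u₀)) (𝓝 fun _ => y₀) := by
    refine tendsto_pi_nhds.2 fun k => tendsto_pi_nhds.2 fun j => ?_
    simp only [w, chainSequence]
    split_ifs with h0 h1
    · exact tendsto_pi_nhds.1 hv j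
    · have hc : Continuous fun q : ((Σ j : Fin 2, Fin (r j)) → ℝ) × (Fin 2 → ℝ) =>
          q.1 ⟨j, ⟨k - 1, h1⟩⟩ := by fun_prop
      exact hc.tendsto (z₀, u₀)
    · exact tendsto_const_nhds
  let N := r 0 + r 1 + 1
  have htraj : Tendsto (fun q => trajectoryOf (fun p => (f p, g p)) sol
      (equilibriumPoint ζ₀ x₀ u₀) N (w q)) (𝓝 (z₀, u₀)) (𝓝 (equilibriumPoint ζ₀ x₀ u₀)) :=
    (tendsto_trajectoryOf hac heq hsolc hsol₀ N).comp hw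
  have hout : ∀ᶠ q in 𝓝 (z₀, u₀), ∀ k : Fin N, backShift ψ (fun p => φ p.2) k
      (trajectoryOf (fun p => (f p, g p)) sol (equilibriumPoint ζ₀ x₀ u₀) N (w q)) = w q k :=
    eventually_all.2 fun k => hw.eventually (eventually_backShift_trajectoryOf hac heq hsolc hsol₀
      hψ.left_inv hsolφ N k k.isLt)
  -- The input after the step plays no role; `u₀` merely keeps the point near the equilibrium.
  have hnext := tendsto_forwardStep (u := fun _ => u₀) hac heq htraj tendsto_const_nhds
  have htraj2 := (continuous_snd.tendsto _).comp htraj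
  filter_upwards [hout, htraj.eventually hF, hnext.eventually hF, hnext.eventually hH,
    htraj2.eventually hψ.left_inv, htraj2.eventually hsol.left_inv, hxu.eventually hsol.left_inv]
    with q hq hp hp' hHp hinv hu hu'
  set p := trajectoryOf (fun p => (f p, g p)) sol (equilibriumPoint ζ₀ x₀ u₀) N (w q)
  have hN : ∀ j, r j < N := by intro j; fin_cases j <;> simp [N]
  have hz : strictShifts ψ (fun p => φ p.2) r p = q.1 := by
    ext ⟨j, k⟩
    have := hN j
    have hk := k.isLt
    exact (congrFun (hq ⟨k + 1, by omega⟩) j).trans (chainSequence_succ _ _ _ j k)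
  rw [hz] at hp
  have hφp : φ p.2 = φ (Fx q.1, q.2) :=
    (hq ⟨0, by omega⟩).trans (chainSequence_zero _ _ _)
  -- The chains determine the state, and state and current output determine the input because `φ(x,
  -- ·)` is locally invertible.
  have hp2 : p.2 = (Fx q.1, q.2) := by
    have h1 : sol (p.2.1, φ p.2) = p.2.2 := congrArg Prod.snd hu
    have h2 : sol (Fx q.1, φ (Fx q.1, q.2)) = q.2 := congrArg Prod.snd hu'
    refine Prod.ext hp ?_
    rw [← h1, hφp, hp, h2]
  have hz' : strictShifts ψ (fun p => φ p.2) r (forwardStep (fun p => (f p, g p)) u₀ p) =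
      chainShift r q.1 + chainInput r (φ (Fx q.1, q.2)) := by
    ext s
    have := hN s.1
    have hk := s.2.isLt
    rw [chainShift_add_chainInput_apply _ y₀]
    simp only [strictShifts]
    rw [backShift_succ_forwardStep _ _ hinv]
    exact congrFun (hq ⟨s.2, by omega⟩) s.1
  rw [hz'] at hp'
  refine Prod.ext ?_ ?_
  · ext k
    simp only [tailAndState, prelongation]
    split_ifs with hk
    · rw [← hz', ← hp2]
      refine Eq.trans ?_ hHp
      simp [strictShifts, hk]
    · have h0 : σ + (k : ℕ) ≠ 0 := by omega
      rw [Pi.add_apply, chainShift_apply, chainInput_apply, if_neg h0, if_neg h0, add_zero]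
      refine congrArg (fun l => q.1 ⟨0, l⟩) (Fin.ext ?_)
      simp only
      omega
  · simp only [tailAndState, prelongation]
    rw [← hp', ← hp2]
    rfl

end Assembly

/-! ### Smoothness and derivative of the coordinate change -/

section TailAndState

variable {n : ℕ} {r : Fin 2 → ℕ} {σ d : ℕ}
  {F : ((Σ j : Fin 2, Fin (r j)) → ℝ) → (Fin n → ℝ)} {z : (Σ j : Fin 2, Fin (r j)) → ℝ}

theorem SmoothNear.tailAndState (hF : SmoothNear F z) (hσ : σ + d = r 0) :
    SmoothNear (tailAndState hσ F) z :=
  SmoothNear.prodMk (ContDiff.smoothNear (by fun_prop) z) hF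

theorem fderiv_tailAndState (hF : DifferentiableAt ℝ F z) (hσ : σ + d = r 0)
    (w : (Σ j : Fin 2, Fin (r j)) → ℝ) :
    fderiv ℝ (tailAndState hσ F) z w = tailAndState hσ (fderiv ℝ F z) w := by
  have h1 : HasFDerivAt
      (fun (z : (Σ j : Fin 2, Fin (r j)) → ℝ) (k : Fin d) => z ⟨0, ⟨σ + k, by omega⟩⟩)
      (ContinuousLinearMap.pi fun k : Fin d =>
        ContinuousLinearMap.proj (R := ℝ) (φ := fun _ : Σ j : Fin 2, Fin (r j) => ℝ)
          ⟨0, ⟨σ + k, by omega⟩⟩) z :=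
    (ContinuousLinearMap.pi fun k : Fin d =>
        ContinuousLinearMap.proj (R := ℝ) (φ := fun _ : Σ j : Fin 2, Fin (r j) => ℝ)
          ⟨0, ⟨σ + k, by omega⟩⟩).hasFDerivAt
  have h2 := h1.prodMk hF.hasFDerivAt
  exact congrArg (fun D => D w) (HasFDerivAt.fderiv (f := _root_.tailAndState hσ F) h2)

end TailAndState

/-- A system that is conjugate to a family of chains of integrators is static feedback
linearizable. -/
theorem isStaticFeedbackLinearizableAt_of_chains {ι E : Type*} [Fintype ι] [DecidableEq ι]
    [NormedAddCommGroup E] [NormedSpace ℝ E] {r : ι → ℕ} {F : E × (ι → ℝ) → E} {s₀ : E}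
    {u₀ : ι → ℝ} {Ψ : ((Σ j : ι, Fin (r j)) → ℝ) → E} {z₀ : (Σ j : ι, Fin (r j)) → ℝ}
    (hs : SmoothNear Ψ z₀) (hb : Function.Bijective (fderiv ℝ Ψ z₀)) (hs₀ : Ψ z₀ = s₀)
    {V Vinv : E × (ι → ℝ) → (ι → ℝ)}
    (hV : LocalDiffeoPair (fun q : E × (ι → ℝ) => (q.1, V q)) (fun q => (q.1, Vinv q)) (s₀, u₀))
    (hz₀ : chainShift r z₀ + chainInput r (V (s₀, u₀)) = z₀)
    (hF : ∀ᶠ q in 𝓝 (z₀, u₀),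
      Ψ (chainShift r q.1 + chainInput r (V (Ψ q.1, q.2))) = F (Ψ q.1, q.2)) :
    IsStaticFeedbackLinearizableAt F s₀ u₀ := by
  obtain ⟨Φ, hΦ⟩ := hs.exists_localDiffeoPair hb
  let e₀ : ((Σ j : ι, Fin (r j)) → ℝ) ≃ₗ[ℝ] E :=
    LinearEquiv.ofBijective (fderiv ℝ Ψ z₀).toLinearMap hb
  have : FiniteDimensional ℝ E := e₀.finiteDimensional
  let e : ((Σ j : ι, Fin (r j)) → ℝ) ≃L[ℝ] E := e₀.toContinuousLinearEquiv
  have hpow : ∀ k, (e₀.toLinearMap ∘ₗ chainShift r ∘ₗ e₀.symm.toLinearMap) ^ k =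
      e₀.toLinearMap ∘ₗ (chainShift r ^ k) ∘ₗ e₀.symm.toLinearMap := by
    intro k
    induction k with
    | zero => ext v; simp
    | succ k ih => rw [pow_succ, ih, pow_succ]; ext v; simp
  -- The linear coordinates must lie in `E` itself, so the chain form is transported by the
  -- isomorphism `e`, the derivative of `Ψ` at `z₀`.
  refine ⟨fun s => e (Φ s), fun s => Ψ (e.symm s), V, Vinv,
    e₀.toLinearMap ∘ₗ chainShift r ∘ₗ e₀.symm.toLinearMap, e₀.toLinearMap ∘ₗ chainInput r,
    hs₀ ▸ hΦ.symm.trans (e.localDiffeoPair _), hV, ?_, ?_⟩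
  · have hrange : ∀ k, LinearMap.range
        (((e₀.toLinearMap ∘ₗ chainShift r ∘ₗ e₀.symm.toLinearMap) ^ k) ∘ₗ
          (e₀.toLinearMap ∘ₗ chainInput r)) =
        (LinearMap.range ((chainShift r ^ k) ∘ₗ chainInput r)).map e₀.toLinearMap := by
      intro k
      rw [hpow, ← LinearMap.range_comp]
      congr 1
      ext v
      simp
    simp_rw [hrange]
    rw [← Submodule.map_iSup, iSup_range_chainShift_pow_chainInput, Submodule.map_top,
      LinearEquiv.range]
  · have hΦ₀ : Φ s₀ = z₀ := hs₀ ▸ hΦ.inv_apply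
    have hΦc : Tendsto Φ (𝓝 s₀) (𝓝 z₀) := by
      have := hΦ.smooth_inv.continuousAt.tendsto
      rwa [hΦ.inv_apply, hs₀] at this
    have h1 : Tendsto (fun q : E × (ι → ℝ) => (Φ q.1, q.2)) (𝓝 (s₀, u₀)) (𝓝 (z₀, u₀)) :=
      (hΦc.comp (continuous_fst.tendsto _)).prodMk_nhds (continuous_snd.tendsto (s₀, u₀))
    have hΨ : ∀ᶠ q in 𝓝 (s₀, u₀), Ψ (Φ q.1) = q.1 :=
      (continuous_fst.tendsto (s₀, u₀)).eventually (hs₀ ▸ hΦ.right_inv)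
    have hVc : Tendsto V (𝓝 (s₀, u₀)) (𝓝 (V (s₀, u₀))) :=
      (continuous_snd.tendsto _).comp hV.smooth.continuousAt.tendsto
    have hA := (LinearMap.continuous_of_finiteDimensional (chainShift r)).tendsto z₀
    have hB := (LinearMap.continuous_of_finiteDimensional (chainInput r)).tendsto (V (s₀, u₀))
    have h2 := ((hA.comp hΦc).comp (continuous_fst.tendsto (s₀, u₀))).add (hB.comp hVc)
    rw [hz₀] at h2
    filter_upwards [h1.eventually hF, hΨ, h2.eventually hΦ.left_inv] with q hq hq' hl
    simp only [hq'] at hq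
    rw [← hq]
    change e₀ (Φ (Ψ _)) = e₀ (chainShift r (e₀.symm (e₀ (Φ q.1)))) + e₀ (chainInput r (V q))
    rw [LinearEquiv.symm_apply_apply, ← map_add]
    exact congrArg e₀ hl

theorem mainTheorem4 (n : ℕ)
    (f : (Fin n → ℝ) × (Fin 2 → ℝ) → (Fin n → ℝ))
    (x₀ : Fin n → ℝ) (u₀ : Fin 2 → ℝ) (hf : IsSystemAt f x₀ u₀)
    -- the variables `ζ = g(x, u)` and the inverse `ψ` of `(x, u) ↦ (f(x, u), g(x, u))`
    (g : (Fin n → ℝ) × (Fin 2 → ℝ) → (Fin 2 → ℝ))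
    (ψ : (Fin n → ℝ) × (Fin 2 → ℝ) → (Fin n → ℝ) × (Fin 2 → ℝ))
    (hψ : LocalDiffeoPair (fun p => (f p, g p)) ψ (x₀, u₀))
    -- the output `y = φ(x, u)`, on the space with the coordinates `(…, ζ_{[-1]}, x, u)`
    (φ : (Fin n → ℝ) × (Fin 2 → ℝ) → (Fin 2 → ℝ)) (hφ : SmoothNear φ (x₀, u₀))
    (hφu : jacobianRank (fderiv ℝ (fun u => φ (x₀, u)) u₀) = 2)
    (P₀ : ShiftSpace n 2) (hP₀ : P₀ = equilibriumPoint (g (x₀, u₀)) x₀ u₀)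
    (y : ShiftSpace n 2 → Fin 2 → ℝ) (hy : y = fun p => φ p.2)
    -- it is a backward-flat output with the minimal orders `r = (r_{1,1}, r_{1,2})`
    (r : Fin 2 → ℕ)
    (Fx : ((Σ j : Fin 2, Fin (r j)) → ℝ) → (Fin n → ℝ))
    (Fu : ((Σ j : Fin 2, Fin (r j + 1)) → ℝ) → (Fin 2 → ℝ))
    (hF : IsBackwardFlatParam ψ P₀ y r Fx Fu)
    (hr : IsLeast {R : Fin 2 → ℕ | HasBackwardFlatParam ψ P₀ y R} r)
    -- `γ₁` is the first order for which `ζ_{[-1]}` appears in `y^1_{[-γ₁]}`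
    (γ₁ : ℕ) (hγ : IsLeast {k : ℕ | ZetaAppears P₀ (fun p => backShift ψ y k p 0)} γ₁)
    -- regularity of the equilibrium
    (hregγ : zetaDeriv (fun p => backShift ψ y γ₁ p 0) P₀ ≠ 0)
    (hregr : ∀ k : Fin (r 1), (k : ℕ) + 1 = r 1 →
      fderiv ℝ Fx (strictShifts ψ y r P₀) (Pi.single ⟨1, k⟩ 1) ≠ 0) :
    ∃ d : ℕ, (d : ℤ) = (∑ j, (r j : ℤ)) - (n : ℤ) ∧ (d : ℤ) = (r 0 : ℤ) - (γ₁ : ℤ) + 1 ∧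
      -- the invertible transformation `ζ̄_{[-1]} = T(x, ζ_{[-1]})`, `ζ_{[-1]} = Φ(x, ζ̄_{[-1]})`
      ∃ T Φ : (Fin n → ℝ) × (Fin 2 → ℝ) → (Fin 2 → ℝ),
        LocalDiffeoPair (fun q : (Fin n → ℝ) × (Fin 2 → ℝ) => (q.1, T q))
          (fun q : (Fin n → ℝ) × (Fin 2 → ℝ) => (q.1, Φ q)) (x₀, g (x₀, u₀)) ∧
        -- the forward shift of `ζ̄^1_{[-1]}`
        ∃ gbar : (Fin n → ℝ) × (Fin 2 → ℝ) → ℝ, (gbar = fun p => T (f p, g p) 0) ∧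
          IsStaticFeedbackLinearizableAt (prelongation f gbar d)
            ((fun _ => gbar (x₀, u₀)), x₀) u₀ := by
  subst hP₀ hy
  set ζ₀ := g (x₀, u₀)
  have heq : (f (x₀, u₀), g (x₀, u₀)) = (x₀, ζ₀) := by rw [hf.equilibrium]
  have hψ₀ : ψ (x₀, ζ₀) = (x₀, u₀) := heq ▸ hψ.inv_apply
  have hψs : SmoothNear ψ (x₀, ζ₀) := heq ▸ hψ.smooth_inv
  have hφu₁ : Function.Bijective (fderiv ℝ (fun u => φ (x₀, u)) u₀) :=
    bijective_of_jacobianRank_eq hφu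
  have hφu₂ : Function.Bijective fun μ => fderiv ℝ φ (x₀, u₀) (0, μ) := by
    simpa only [← fderiv_comp_prodMk hφ.differentiableAt] using hφu₁
  have hz₀ : strictShifts ψ (fun p => φ p.2) r (equilibriumPoint ζ₀ x₀ u₀) =
      fun s => φ (x₀, u₀) s.1 := strictShifts_equilibriumPoint hψ₀
  have hFs := hF.smooth_x
  rw [hz₀] at hFs hregr
  have hF₀ : Fx (fun s => φ (x₀, u₀) s.1) = x₀ := by
    rw [← hz₀]
    exact hF.param_x.self_of_nhds.symm
  -- The output `φ(x, u)` does not contain `ζ_{[-1]}`, so `γ₁ ≥ 1`.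
  obtain ⟨σ, rfl⟩ : ∃ σ, γ₁ = σ + 1 := by
    cases γ₁ with
    | zero =>
      refine absurd ?_ hregγ
      simp [zetaDeriv, backShift]
    | succ σ => exact ⟨σ, rfl⟩
  have hσ : ∀ k < σ, ¬ ZetaAppears (equilibriumPoint ζ₀ x₀ u₀)
      fun p => backShift ψ (fun p => φ p.2) (k + 1) p 0 := fun k hk happ => by
    have := hγ.2 happ
    omega
  obtain ⟨H, hHs, hH⟩ := exists_backShift_eq hψs hψ₀ hφ 0 σ fun i h1 h2 => by
    obtain ⟨i, rfl⟩ : ∃ i', i = i' + 1 := ⟨i - 1, by omega⟩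
    exact hσ i (by omega)
  have hne : ∃ η, fderiv ℝ H (x₀, ζ₀) (0, η) ≠ 0 := by
    by_contra! hall
    refine hregγ (ContinuousLinearMap.ext fun η => ?_)
    rw [zetaDeriv_equilibriumPoint hHs hH, hall]
    rfl
  have hlin := isLinearBackwardFlat_fderiv hψ heq hφ hφu₂ hFs hF.param_x hσ hHs hH hne hregr
  obtain ⟨d, hd⟩ : ∃ d, σ + d = r 0 := ⟨r 0 - σ, by have := hlin.le_order; omega⟩
  have hbij : Function.Bijective
      (fderiv ℝ (tailAndState hd Fx) fun s => φ (x₀, u₀) s.1) := by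
    constructor
    · rw [injective_iff_map_eq_zero]
      intro w hw
      rw [fderiv_tailAndState hFs.differentiableAt] at hw
      exact hlin.tailAndState_injective hd hw
    · intro s
      obtain ⟨w, hw⟩ := hlin.tailAndState_surjective hd s
      exact ⟨w, (fderiv_tailAndState hFs.differentiableAt hd w).trans hw⟩
  have hdim := (LinearEquiv.ofBijective (fderiv ℝ (tailAndState hd Fx)
    fun s => φ (x₀, u₀) s.1).toLinearMap hbij).finrank_eq
  simp only [Module.finrank_fintype_fun_eq_card, Fintype.card_sigma, Fintype.card_fin,
    Module.finrank_prod, Fin.sum_univ_two] at hdim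
  obtain ⟨T, Φ, hT, hTH⟩ := hHs.exists_completion hne
  refine ⟨d, ?_, ?_, T, Φ, hT, _, rfl, ?_⟩
  · rw [Fin.sum_univ_two]; omega
  · push_cast; omega
  simp only [hTH]
  -- The linearizing feedback is the flat output itself, `v = φ(x, u)`.
  have hV : SmoothNear (fun q : ((Fin d → ℝ) × (Fin n → ℝ)) × (Fin 2 → ℝ) => φ (q.1.2, q.2))
      ((fun _ => H (f (x₀, u₀), g (x₀, u₀)), x₀), u₀) :=
    SmoothNear.comp (k := φ) (h := fun q : ((Fin d → ℝ) × (Fin n → ℝ)) × (Fin 2 → ℝ) =>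
      (q.1.2, q.2)) hφ (ContDiff.smoothNear (by fun_prop) _)
  obtain ⟨Vinv, hVinv⟩ := hV.exists_fiberwise_localDiffeoPair (by
    simpa only [← fderiv_comp_prodMk hV.differentiableAt] using hφu₁)
  refine isStaticFeedbackLinearizableAt_of_chains (hFs.tailAndState hd) hbij ?_ hVinv ?_
    (eventually_tailAndState_chain hψ heq hφ hφu₂ hFs hF.param_x hF₀ hH hd)
  · have hH₀ : φ (x₀, u₀) 0 = H (x₀, ζ₀) := by
      have := hH.self_of_nhds
      simp only [backShift, iterate_backStep_equilibriumPoint hψ₀] at this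
      exact this
    rw [heq, ← hH₀]
    exact Prod.ext rfl hF₀
  · ext s
    rw [chainShift_add_chainInput_apply _ (φ (x₀, u₀))]
    simp only [chainSequence]
    split_ifs <;> rfl
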